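/- Let $k$ be a field of characteristic $0$ and let $\mathcal C$ be a $k$-linear abelian braided monoidal category whose tensor product is $k$-linear and right exact in each variable, satisfying the following two conditions. (PF) $\mathcal C$ has a projective generator with finite-dimensional endomorphism space. Here a projective generator is a projective object $P$ such that every object is a quotient of $P^{\oplus m}$ for some $m\in\mathbb N$. (C) $\mathcal C$ is equipped with a contravariant $k$-linear functor $(-)^*:\mathcal C\to\mathcal C$, natural isomorphisms $\delta_U:U\to U^{**}$ with $(\delta_U)^*=(\delta_{U^*})^{-1}$, and linear isomorphisms $\pi_{U,V}:\mathcal C(U,V^*)\to\mathcal C(U\otimes V,\mathbf 1^*)$ natural in $U$ and $V$. Put $\beta_U:=\pi_{U,U^*}(\delta_U):U\otimes U^*\to\mathbf 1^*$. Let $(\mathcal C^2,\boxtimes)$, $\mathcal C^2=\mathcal C\boxtimes\mathcal C^{\mathrm{rev}}$, be the Deligne product: $\mathcal C^2$ is a $k$-linear abelian category, $\boxtimes:\mathcal C\times\mathcal C\to\mathcal C^2$ is $k$-linear and right exact in each variable, and for every $k$-linear abelian category $\mathcal B$, composition with $\boxtimes$ is an equivalence from the category of $k$-linear right exact functors $\mathcal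 C^2\to\mathcal B$ to the category of functors $\mathcal C\times\mathcal C\to\mathcal B$ that are $k$-linear and right exact in each variable. (As an underlying category $\mathcal C\boxtimes\mathcal C^{\mathrm{rev}}$ is $\mathcal C\boxtimes\mathcal C$; "rev" only refers to the braiding.) Let $T:\mathcal C^2\to\mathcal C$ be the $k$-linear right exact functor induced by the tensor product, with its natural isomorphism $T(U\boxtimes V)\cong U\otimes V$, which is suppressed from the notation. Let $P$ be any projective generator of $\mathcal C$ and let $N\subset\mathcal C^2(P\boxtimes P,P\boxtimes P^*)$ be the linear subspace of all $f$ with $\beta_P\circ T(f)=0$. Then: (1) $N$ is finite-dimensional. (2) Let $u_1,\dots,u_{|N|}$ be any basis of $N$ (so $|N|=\dim_k N$), let $n=\sum_i u_i\circ\pi_i:(P\boxtimes P)^{\oplus|N|}\to P\boxtimes P^*$, with $\pi_i$ the projection to the $i$-th summand, and let $R'=\operatorname{cok}(n)$. There is a unique morphism $r':T(R')\to\mathbf 1^*$ with $r'\circ T(\operatorname{cok}(n))=\beta_P$, and $R'$ represents the functor $\mathcal C(T(-),\mathbf 1^*)$: there is an isomorphism of $k$-vector spaces $\chi_X:\mathcal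 C(T(X),\mathbf 1^*)\to\mathcal C^2(X,R')$, natural in $X\in\mathcal C^2$, and it can be chosen such that $\chi_{R'}(r')=\mathrm{id}_{R'}$. (3) In particular, a representing object $R_{\mathbf 1^*}$ of the functor $\mathcal C(T(-),\mathbf 1^*)$ from $\mathcal C^2$ to $k$-vector spaces exists. -/

import Mathlib

open CategoryTheory CategoryTheory.Limits CategoryTheory.MonoidalCategory Opposite

universe w v u u' t

section LinearAbelian

variable (k : Type w) [Field k]

/-- A `k`-linear right exact functor between `k`-linear abelian categories. -/
structure IsLinearRightExact {A : Type u} [Category.{v} A] [Abelian A] [Linear k A]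
    {B : Type u'} [Category.{v} B] [Abelian B] [Linear k B] (F : A ⥤ B) : Prop where
  additive : F.Additive
  linear : F.Linear k
  rightExact : PreservesFiniteColimits F

/-- A functor of two variables which is `k`-linear and right exact in each variable. -/
structure IsBilinearRightExact {A : Type u} [Category.{v} A] [Abelian A] [Linear k A]
    {A' : Type u'} [Category.{v} A'] [Abelian A'] [Linear k A']
    {B : Type t} [Category.{v} B] [Abelian B] [Linear k B] (F : A ⥤ A' ⥤ B) : Prop where
  left : ∀ Y : A', IsLinearRightExact k (F.flip.obj Y)
  right : ∀ X : A, IsLinearRightExact k (F.obj X)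

/-- The category of `k`-linear right exact functors `A ⥤ B`, with all natural transformations. -/
abbrev LinRexFunctor (A : Type u) [Category.{v} A] [Abelian A] [Linear k A]
    (B : Type u') [Category.{v} B] [Abelian B] [Linear k B] :=
  ObjectProperty.FullSubcategory (fun F : A ⥤ B => IsLinearRightExact k F)

/-- The category of functors of two variables, `k`-linear and right exact in each variable,
with all natural transformations. -/
abbrev BilinRexFunctor (A : Type u) [Category.{v} A] [Abelian A] [Linear k A]
    (A' : Type u') [Category.{v} A'] [Abelian A'] [Linear k A']
    (B : Type t) [Category.{v} B] [Abelian B] [Linear k B] :=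
  ObjectProperty.FullSubcategory (fun F : A ⥤ A' ⥤ B => IsBilinearRightExact k F)

end LinearAbelian

section DeligneProduct

variable (k : Type w) [Field k]

/-- Post-composing a functor which is linear right exact in each variable with a
linear right exact functor. -/
theorem IsBilinearRightExact.comp
    {A : Type u} [Category.{v} A] [Abelian A] [Linear k A]
    {D : Type u'} [Category.{v} D] [Abelian D] [Linear k D]
    {B : Type t} [Category.{v} B] [Abelian B] [Linear k B]
    {box : A ⥤ A ⥤ D} (hbox : IsBilinearRightExact k box)
    {F : D ⥤ B} (hF : IsLinearRightExact k F) :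
    IsBilinearRightExact k ((Functor.postcompose₂.obj F).obj box) := by
  obtain ⟨h1, h2, h3⟩ := hF
  constructor
  · intro Y
    obtain ⟨g1, g2, g3⟩ := hbox.left Y
    exact ⟨inferInstanceAs (box.flip.obj Y ⋙ F).Additive,
      inferInstanceAs ((box.flip.obj Y ⋙ F).Linear k),
      inferInstanceAs (PreservesFiniteColimits (box.flip.obj Y ⋙ F))⟩
  · intro X
    obtain ⟨g1, g2, g3⟩ := hbox.right X
    exact ⟨inferInstanceAs (box.obj X ⋙ F).Additive,
      inferInstanceAs ((box.obj X ⋙ F).Linear k),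
      inferInstanceAs (PreservesFiniteColimits (box.obj X ⋙ F))⟩

/-- The functor `F ↦ F ∘ ⊠` from linear right exact functors on `D` to functors of two
variables on `A` that are linear right exact in each variable. -/
def restrictAlong
    {A : Type u} [Category.{v} A] [Abelian A] [Linear k A]
    {D : Type u'} [Category.{v} D] [Abelian D] [Linear k D]
    {box : A ⥤ A ⥤ D} (hbox : IsBilinearRightExact k box)
    (B : Type t) [Category.{v} B] [Abelian B] [Linear k B] :
    LinRexFunctor k D B ⥤ BilinRexFunctor k A A B :=
  ObjectProperty.lift _
    (ObjectProperty.ι _ ⋙ Functor.postcompose₂.flip.obj box)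
    (fun F => hbox.comp k F.property)

/-- `(D, ⊠)` is a Deligne product of the `k`-linear abelian category `A` with itself: `⊠` is
`k`-linear and right exact in each variable, and for every `k`-linear abelian category `B`,
composition with `⊠` is an equivalence from the category of `k`-linear right exact functors
`D ⥤ B` to the category of functors from `A × A` (in curried form) to `B` that are `k`-linear
and right exact in each variable.  The universe `t` bounds the size of the test categories. -/
structure IsDeligneSquare
    {A : Type u} [Category.{v} A] [Abelian A] [Linear k A]
    {D : Type u'} [Category.{v} D] [Abelian D] [Linear k D] (box : A ⥤ A ⥤ D) : Prop where
  bilinear : IsBilinearRightExact k box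
  universal : ∀ (B : Type t) [Category.{v} B] [Abelian B] [Linear k B],
    (restrictAlong k bilinear B).IsEquivalence

end DeligneProduct

section Finiteness

instance hasFiniteBiproductsOfAbelian {A : Type u} [Category.{v} A] [Abelian A] :
    HasFiniteBiproducts A :=
  Abelian.hasFiniteBiproducts

/-- `P` is projective and every object is a quotient of a finite direct sum of copies of `P`. -/
structure IsProjectiveGenerator {A : Type u} [Category.{v} A] [Abelian A] (P : A) : Prop where
  projective : Projective P
  generates : ∀ U : A, ∃ (m : ℕ) (s : (⨁ fun _ : Fin m => P) ⟶ U), Epi s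

/-- The finiteness condition (PF): there is a projective generator with finite-dimensional
endomorphism space. -/
def SatisfiesPF (k : Type w) [Field k] (A : Type u) [Category.{v} A] [Abelian A] [Linear k A] :
    Prop :=
  ∃ P : A, IsProjectiveGenerator P ∧ FiniteDimensional k (P ⟶ P)

end Finiteness

section Conjugates

/-- Conjugates on a `k`-linear monoidal category: an involutive contravariant `k`-linear functor
`U ↦ U^*` with natural isomorphisms `δ_U : U ≅ U^**` satisfying `(δ_U)^* = (δ_{U^*})⁻¹`, and
isomorphisms `π_{U,V} : Hom(U, V^*) ≅ Hom(U ⊗ V, 𝟙^*)` natural in `U` and `V`. -/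
structure Conjugates (k : Type w) [Field k] (C : Type u) [Category.{v} C] [Abelian C]
    [Linear k C] [MonoidalCategory C] where
  star : Cᵒᵖ ⥤ C
  star_add : ∀ {U V : C} (f g : U ⟶ V), star.map (f + g).op = star.map f.op + star.map g.op
  star_smul : ∀ {U V : C} (a : k) (f : U ⟶ V), star.map (a • f).op = a • star.map f.op
  δ : 𝟭 C ≅ star.rightOp ⋙ star
  star_δ : ∀ U : C, star.map (δ.hom.app U).op = δ.inv.app (star.obj (op U))
  π : ∀ U V : C, (U ⟶ star.obj (op V)) ≃ₗ[k] (U ⊗ V ⟶ star.obj (op (𝟙_ C)))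
  π_natural_left : ∀ {X U : C} (V : C) (a : X ⟶ U) (q : U ⟶ star.obj (op V)),
    π X V (a ≫ q) = (a ▷ V) ≫ π U V q
  π_natural_right : ∀ (U : C) {Y V : C} (b : Y ⟶ V) (q : U ⟶ star.obj (op V)),
    π U Y (q ≫ star.map b.op) = (U ◁ b) ≫ π U V q

namespace Conjugates

variable {k : Type w} [Field k] {C : Type u} [Category.{v} C] [Abelian C]
  [Linear k C] [MonoidalCategory C] (c : Conjugates k C)

/-- The conjugate object `U^*`. -/
abbrev conj (U : C) : C := c.star.obj (op U)

/-- The canonical non-degenerate pairing `β_U = π_{U,U^*}(δ_U) : U ⊗ U^* ⟶ 𝟙^*`. -/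
def pairing (U : C) : U ⊗ c.conj U ⟶ c.conj (𝟙_ C) :=
  c.π U (c.conj U) (c.δ.hom.app U)

end Conjugates

end Conjugates

section Construction

variable {k : Type w} [Field k] {C : Type u} [Category.{v} C] [Abelian C]
  [Linear k C] [MonoidalCategory C] (c : Conjugates k C)
  {D : Type u'} [Category.{v} D] [Abelian D] [Linear k D] {box : C ⥤ C ⥤ D}
  {T : D ⥤ C} (hT : IsLinearRightExact k T)
  (τ : (Functor.postcompose₂.obj T).obj box ≅ curriedTensor C)

/-- The component `T(U ⊠ V) ≅ U ⊗ V` of an isomorphism `τ : T ∘ ⊠ ≅ ⊗`. -/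
def boxTensorIso (U V : C) : T.obj ((box.obj U).obj V) ≅ U ⊗ V :=
  (τ.app U).app V

/-- The subspace `N` of `Hom(P ⊠ P, P ⊠ P^*)` of all `f` with `β_P ∘ T(f) = 0`, where
`T(P ⊠ Q)` is identified with `P ⊗ Q`. -/
def relationSpace (P : C) :
    Submodule k ((box.obj P).obj P ⟶ (box.obj P).obj (c.conj P)) where
  carrier := {f | (boxTensorIso τ P P).inv ≫ T.map f ≫
    (boxTensorIso τ P (c.conj P)).hom ≫ c.pairing P = 0}
  zero_mem' := by
    have := hT.additive
    simp
  add_mem' := by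
    have := hT.additive
    intro f g hf hg
    change _ ≫ T.map f ≫ _ ≫ _ = 0 at hf
    change _ ≫ T.map g ≫ _ ≫ _ = 0 at hg
    change _ ≫ T.map (f + g) ≫ _ ≫ _ = 0
    rw [T.map_add, Preadditive.add_comp, Preadditive.comp_add, hf, hg, add_zero]
  smul_mem' := by
    have := hT.linear
    intro a f hf
    change _ ≫ T.map f ≫ _ ≫ _ = 0 at hf
    change _ ≫ T.map (a • f) ≫ _ ≫ _ = 0
    rw [T.map_smul, Linear.smul_comp, Linear.comp_smul, hf, smul_zero]

/-- The map `n = ∑ᵢ uᵢ ∘ πᵢ : (P ⊠ P)^{⊕ r} ⟶ P ⊠ P^*` built from a basis `u₁, …, u_r`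
of `N`. -/
noncomputable def relationMap (P : C) {r : ℕ}
    (b : Module.Basis (Fin r) k (relationSpace c hT τ P)) :
    (⨁ fun _ : Fin r => (box.obj P).obj P) ⟶ (box.obj P).obj (c.conj P) :=
  ∑ i : Fin r, biproduct.π (fun _ : Fin r => (box.obj P).obj P) i ≫
    (b i : (box.obj P).obj P ⟶ (box.obj P).obj (c.conj P))

end Construction

/-! Put `Q = P ⊠ P` and let `r'` be the map induced by `β_P` on the cokernel `R'`. The
transformation `f ↦ r' ∘ T f` from `Hom(-, R')` to `Hom(T -, 𝟙^*)` compares functors that turn right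
exact sequences into left exact ones, so by `bijective_of_bijective_generator` it is bijective
everywhere once it is so at a generator. At `Q`, injectivity holds because a map to `R'` lifts along
the cokernel by projectivity, and a lift killed by `β_P` lies in `N`, hence factors through `n`.
Surjectivity holds because every `P ⊗ P ⟶ 𝟙^*` is `β_P ∘ (P ⊗ b)` for some `b : P ⟶ P^*`.

The substance is that `Q` is a projective generator with finite-dimensional Hom spaces, which must
come from the universal property of `⊠` alone (`IsDeligneSquare.isProjectiveGenerator`). Let `E =
(End P)ᵒᵖ ⊗ (End P)ᵒᵖ`. The bifunctor `Hom(P, X) ⊗ Hom(P, Y)` extends to a right exact `G` from `D`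
to finitely generated `E`-modules. With `K = Hom(Q, -)` there is a bijection `Hom(X ⊠ Y, W) ≅
Hom_E(G(X ⊠ Y), K W)`: it is clear for `X = Y = P`, where the module is free on `1 ⊗ 1`, and it
spreads in each variable (`bijective_boxAdjoint`). Hence the partial left adjoint of `K` composed
with `G` is a right exact endofunctor fixing all `X ⊠ Y`, so it is isomorphic to the identity. This
gives `Hom(Z, W) ≅ Hom_E(G Z, K W)` for all `Z`, and the properties of the free module `G Q` pass to
`Q` (`isProjectiveGenerator_of_comparison`). -/

section Generator

-- Checking bijectivity on a generator.

universe v₁ v₂ v₃ u₁ u₂ u₃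

variable {A : Type u₁} [Category.{v₁} A] [Abelian A] {B : Type u₂} [Category.{v₂} B] [Abelian B]
  {B' : Type u₃} [Category.{v₃} B'] [Abelian B']

/-- A natural family of additive maps `Hom(S -, W) → Hom(S' -, W')`, where `S` and `S'` are
additive and right exact, is bijective as soon as it is bijective at an object `P` such that
every object is a quotient of a finite direct sum of copies of `P`. -/
theorem bijective_of_bijective_generator
    (S : A ⥤ B) (S' : A ⥤ B') [S.Additive] [S'.Additive]
    [PreservesFiniteColimits S] [PreservesFiniteColimits S'] {W : B} {W' : B'}
    (θ : ∀ X : A, (S.obj X ⟶ W) →+ (S'.obj X ⟶ W'))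
    (hθ : ∀ {X Y : A} (f : X ⟶ Y) (g : S.obj Y ⟶ W), θ X (S.map f ≫ g) = S'.map f ≫ θ Y g)
    {P : A} (hP : ∀ U : A, ∃ (m : ℕ) (s : (⨁ fun _ : Fin m => P) ⟶ U), Epi s)
    (h : Function.Bijective (θ P)) (X : A) : Function.Bijective (θ X) := by
  have total (m : ℕ) : 𝟙 (⨁ fun _ : Fin m => P) =
      ∑ i, biproduct.π (fun _ : Fin m => P) i ≫ biproduct.ι (fun _ : Fin m => P) i :=
    biproduct.total.symm
  have inj₀ (m : ℕ) (f : S.obj (⨁ fun _ : Fin m => P) ⟶ W) (hf : θ _ f = 0) : f = 0 := by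
    rw [← Category.id_comp f, ← S.map_id, total, S.map_sum, Preadditive.sum_comp]
    refine Finset.sum_eq_zero fun i _ => ?_
    have : S.map (biproduct.ι (fun _ : Fin m => P) i) ≫ f = 0 := by
      apply h.1
      rw [hθ, hf, comp_zero, map_zero]
    rw [S.map_comp, Category.assoc, this, comp_zero]
  have inj (X : A) (f : S.obj X ⟶ W) (hf : θ _ f = 0) : f = 0 := by
    obtain ⟨m, s, hs⟩ := hP X
    have : S.map s ≫ f = 0 := inj₀ m _ (by rw [hθ, hf, comp_zero])
    rwa [← cancel_epi (S.map s), comp_zero]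
  refine ⟨(injective_iff_map_eq_zero _).2 (inj X), fun g => ?_⟩
  obtain ⟨m, s, hs⟩ := hP X
  choose e he using fun i =>
    h.2 (S'.map (biproduct.ι (fun _ : Fin m => P) i) ≫ S'.map s ≫ g)
  -- Preimages over the summands glue to a preimage of `S'.map s ≫ g` over the cover `P^m` of `X`.
  let f₀ : S.obj (⨁ fun _ : Fin m => P) ⟶ W :=
    ∑ i, S.map (biproduct.π (fun _ : Fin m => P) i) ≫ e i
  have hf₀ : θ _ f₀ = S'.map s ≫ g := by
    simp only [f₀, map_sum, hθ, he]
    simp only [← Category.assoc, ← Functor.map_comp, ← Preadditive.sum_comp, ← Functor.map_sum,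
      ← total, Category.id_comp]
  let T : ShortComplex A := ShortComplex.mk (kernel.ι s) s (kernel.condition s)
  have hT : T.ShortExact :=
    { exact := ShortComplex.exact_of_f_is_kernel _ (kernelIsKernel s)
      mono_f := inferInstanceAs (Mono (kernel.ι s))
      epi_g := hs }
  obtain ⟨hex, hepi⟩ := (S.preservesFiniteColimits_iff_forall_exact_map_and_epi).1 inferInstance T hT
  -- Injectivity, now known at every object, is used at `kernel s`; it lets `f₀` descend to `S X`.
  have hz : S.map (kernel.ι s) ≫ f₀ = 0 := inj _ _ (by
    rw [hθ, hf₀, ← Category.assoc, ← S'.map_comp, kernel.condition, S'.map_zero, zero_comp])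
  have : Epi (T.map S).g := hepi
  obtain ⟨q, hq⟩ : ∃ q : S.obj X ⟶ W, S.map s ≫ q = f₀ := ⟨hex.desc f₀ hz, hex.g_desc f₀ hz⟩
  exact ⟨q, by rw [← cancel_epi (S'.map s), ← hθ, hq, hf₀]⟩

end Generator

/-! ### Enlarging the universe of objects. -/

section UniverseLift

variable (k : Type w) [Field k]

/-- The lift of a category to a higher universe of objects. -/
abbrev ObjLift (B : Type u) [Category.{v} B] : Type (max u t) :=
  InducedCategory B (ULift.down : ULift.{t} B → B)

variable (B : Type u) [Category.{v} B]

instance : (inducedFunctor (ULift.down : ULift.{t} B → B)).EssSurj :=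
  ⟨fun X => ⟨⟨X⟩, ⟨Iso.refl _⟩⟩⟩

instance : (inducedFunctor (ULift.down : ULift.{t} B → B)).IsEquivalence where

/-- The functor from the lifted category. -/
abbrev ObjLift.down : ObjLift.{v, u, t} B ⥤ B := inducedFunctor _

/-- The functor to the lifted category. -/
def ObjLift.up : B ⥤ ObjLift.{v, u, t} B where
  obj X := ⟨X⟩
  map f := ⟨f⟩

instance : (ObjLift.up.{v, u, t} B).IsEquivalence where
  faithful := ⟨fun h => congrArg InducedCategory.Hom.hom h⟩
  full := ⟨fun f => ⟨f.hom, rfl⟩⟩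
  essSurj := ⟨fun X => ⟨(ObjLift.down.{v, u, t} B).obj X, ⟨Iso.refl _⟩⟩⟩

noncomputable instance [Abelian B] : Abelian (ObjLift.{v, u, t} B) :=
  haveI : HasFiniteProducts (ObjLift.{v, u, t} B) :=
    ⟨fun _ => Adjunction.hasLimitsOfShape_of_equivalence (ObjLift.down.{v, u, t} B)⟩
  abelianOfEquivalence (ObjLift.down.{v, u, t} B)

variable {B} [Abelian B] [Linear k B]

theorem ObjLift.isLinearRightExact_up : IsLinearRightExact k (ObjLift.up.{v, u, t} B) :=
  ⟨⟨rfl⟩, ⟨fun _ _ => rfl⟩, inferInstance⟩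

theorem ObjLift.isLinearRightExact_down : IsLinearRightExact k (ObjLift.down.{v, u, t} B) :=
  ⟨⟨rfl⟩, ⟨fun _ _ => rfl⟩, inferInstance⟩

end UniverseLift

/-! ### Extending functors and isomorphisms along `⊠`. -/

section Deligne

universe s

variable {k : Type w} [Field k]

theorem IsLinearRightExact.comp {A : Type u} [Category.{v} A] [Abelian A] [Linear k A]
    {B : Type u'} [Category.{v} B] [Abelian B] [Linear k B]
    {B' : Type t} [Category.{v} B'] [Abelian B'] [Linear k B']
    {F : A ⥤ B} {F' : B ⥤ B'}
    (hF : IsLinearRightExact k F) (hF' : IsLinearRightExact k F') :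
    IsLinearRightExact k (F ⋙ F') := by
  obtain ⟨h1, h2, h3⟩ := hF
  obtain ⟨g1, g2, g3⟩ := hF'
  exact ⟨inferInstance, inferInstance, inferInstance⟩

variable {A : Type u} [Category.{v} A] [Abelian A] [Linear k A]
  {D : Type u'} [Category.{v} D] [Abelian D] [Linear k D] {box : A ⥤ A ⥤ D}

/-- Essential surjectivity of restriction along `⊠`. The universal property only tests categories
with objects in `max s t`, so `B` is replaced by its lift and the extension is brought back down. -/
theorem IsDeligneSquare.exists_extension
    (h : IsDeligneSquare.{w, v, u, u', max s t} k box)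
    {B : Type s} [Category.{v} B] [Abelian B] [Linear k B]
    {F : A ⥤ A ⥤ B} (hF : IsBilinearRightExact k F) :
    ∃ G : D ⥤ B, IsLinearRightExact k G ∧
      Nonempty ((Functor.postcompose₂.obj G).obj box ≅ F) := by
  have := h.universal (ObjLift.{v, s, t} B)
  let F' : BilinRexFunctor k A A (ObjLift.{v, s, t} B) :=
    ⟨_, hF.comp k (ObjLift.isLinearRightExact_up.{w, v, s, t} k)⟩
  let G' := (restrictAlong k h.bilinear (ObjLift.{v, s, t} B)).objPreimage F'
  let e := (restrictAlong k h.bilinear (ObjLift.{v, s, t} B)).objObjPreimageIso F'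
  let e' := (ObjectProperty.ι _).mapIso e
  refine ⟨G'.obj ⋙ ObjLift.down.{v, s, t} B,
    G'.property.comp (ObjLift.isLinearRightExact_down k), ⟨?_⟩⟩
  exact (Functor.postcompose₂.obj (ObjLift.down.{v, s, t} B)).mapIso e'

/-- Full faithfulness of restriction along `⊠`, after the same universe lift. -/
theorem IsDeligneSquare.nonempty_iso
    (h : IsDeligneSquare.{w, v, u, u', max s t} k box)
    {B : Type s} [Category.{v} B] [Abelian B] [Linear k B]
    {G G' : D ⥤ B} (hG : IsLinearRightExact k G) (hG' : IsLinearRightExact k G')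
    (e : (Functor.postcompose₂.obj G).obj box ≅ (Functor.postcompose₂.obj G').obj box) :
    Nonempty (G ≅ G') := by
  have := h.universal (ObjLift.{v, s, t} B)
  have hup := ObjLift.isLinearRightExact_up.{w, v, s, t} (B := B) k
  let G₁ : LinRexFunctor k D (ObjLift.{v, s, t} B) := ⟨_, hG.comp hup⟩
  let G₂ : LinRexFunctor k D (ObjLift.{v, s, t} B) := ⟨_, hG'.comp hup⟩
  let e₁ : (restrictAlong k h.bilinear (ObjLift.{v, s, t} B)).obj G₁ ≅
      (restrictAlong k h.bilinear (ObjLift.{v, s, t} B)).obj G₂ :=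
    ObjectProperty.isoMk _
      ((Functor.postcompose₂.obj (ObjLift.up.{v, s, t} B)).mapIso e)
  let e₂ := (ObjectProperty.ι _).mapIso
    ((restrictAlong k h.bilinear (ObjLift.{v, s, t} B)).preimageIso e₁)
  exact ⟨Functor.isoWhiskerRight e₂ (ObjLift.down.{v, s, t} B)⟩

end Deligne

/-! ### The module bifunctor `Hom(P, X) ⊗ Hom(P, Y)`. -/

section HomTensor

open TensorProduct

variable (k : Type w) [Field k] {C : Type u} [Category.{v} C] [Abelian C] [Linear k C] (P : C)

instance homIsScalarTower (X : C) : IsScalarTower k (End P)ᵐᵒᵖ (P ⟶ X) where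
  smul_assoc a x f := Linear.smul_comp (R := k) P P X a x.unop f

/-- The algebra `(End P)ᵒᵖ ⊗ (End P)ᵒᵖ`. -/
abbrev EndOpTensor : Type v := (End P)ᵐᵒᵖ ⊗[k] (End P)ᵐᵒᵖ

/-- The action of `(End P)ᵒᵖ ⊗ (End P)ᵒᵖ` on `Hom(P, X) ⊗ Hom(P, Y)`. -/
noncomputable def homTensorAction (X Y : C) :
    EndOpTensor k P →ₐ[k] Module.End k ((P ⟶ X) ⊗[k] (P ⟶ Y)) :=
  Module.endTensorEndAlgHom.comp
    (Algebra.TensorProduct.map (Algebra.lsmul k k (P ⟶ X)) (Algebra.lsmul k k (P ⟶ Y)))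

noncomputable instance homTensorModule (X Y : C) :
    Module (EndOpTensor k P) ((P ⟶ X) ⊗[k] (P ⟶ Y)) :=
  Module.compHom _ (homTensorAction k P X Y).toRingHom

theorem homTensor_smul_def {X Y : C} (e : EndOpTensor k P) (z : (P ⟶ X) ⊗[k] (P ⟶ Y)) :
    e • z = homTensorAction k P X Y e z := rfl

theorem homTensor_smul_tmul {X Y : C} (a b : (End P)ᵐᵒᵖ) (x : P ⟶ X) (y : P ⟶ Y) :
    (a ⊗ₜ[k] b : EndOpTensor k P) • (x ⊗ₜ[k] y) =
      (a.unop ≫ x : P ⟶ X) ⊗ₜ[k] (b.unop ≫ y : P ⟶ Y) := rfl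

theorem homTensor_algebraMap_smul {X Y : C} (r : k) (z : (P ⟶ X) ⊗[k] (P ⟶ Y)) :
    algebraMap k (EndOpTensor k P) r • z = r • z := by
  rw [homTensor_smul_def, AlgHom.commutes, Module.algebraMap_end_apply]

instance (X Y : C) : IsScalarTower k (EndOpTensor k P) ((P ⟶ X) ⊗[k] (P ⟶ Y)) :=
  IsScalarTower.of_algebraMap_smul (homTensor_algebraMap_smul k P)

variable {k P} in
theorem homTensor_hom_ext {X Y : C} {M : Type*} [AddCommGroup M] [Module (EndOpTensor k P) M]
    {φ ψ : (P ⟶ X) ⊗[k] (P ⟶ Y) →ₗ[EndOpTensor k P] M}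
    (h : ∀ (x : P ⟶ X) (y : P ⟶ Y), φ (x ⊗ₜ[k] y) = ψ (x ⊗ₜ[k] y)) : φ = ψ := by
  ext z
  induction z using TensorProduct.induction_on with
  | zero => simp
  | add z z' hz hz' => rw [map_add, map_add, hz, hz']
  | tmul x y => exact h x y

variable {k P} in
/-- A `k`-linear map out of `Hom(P, X) ⊗ Hom(P, Y)` is linear over `(End P)ᵒᵖ ⊗ (End P)ᵒᵖ` if it
commutes with the action on pure tensors. -/
def homTensorLift {X Y : C} {M : Type*} [AddCommGroup M] [Module (EndOpTensor k P) M]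
    (φ : (P ⟶ X) ⊗[k] (P ⟶ Y) →+ M)
    (h : ∀ (a b : End P) (x : P ⟶ X) (y : P ⟶ Y), φ ((a ≫ x : P ⟶ X) ⊗ₜ[k] (b ≫ y : P ⟶ Y)) =
      (MulOpposite.op a ⊗ₜ[k] MulOpposite.op b : EndOpTensor k P) • φ (x ⊗ₜ[k] y)) :
    (P ⟶ X) ⊗[k] (P ⟶ Y) →ₗ[EndOpTensor k P] M :=
  { φ with
    map_smul' := fun e z => by
      change φ (e • z) = e • φ z
      induction e using TensorProduct.induction_on with
      | zero =>
        exact (congrArg φ (zero_smul (EndOpTensor k P) z)).trans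
          (φ.map_zero.trans (zero_smul (EndOpTensor k P) (φ z)).symm)
      | add e e' he he' => rw [add_smul, add_smul, map_add, he, he']
      | tmul a b =>
        induction z using TensorProduct.induction_on with
        | zero => rw [smul_zero, map_zero, smul_zero]
        | add z z' hz hz' => rw [smul_add, map_add, map_add, smul_add, hz, hz']
        | tmul x y => exact h a.unop b.unop x y }

/-- Post-composition in both factors, as a linear map over `(End P)ᵒᵖ ⊗ (End P)ᵒᵖ`. -/
noncomputable def homTensorMap {X X' Y Y' : C} (f : X ⟶ X') (g : Y ⟶ Y') :
    (P ⟶ X) ⊗[k] (P ⟶ Y) →ₗ[EndOpTensor k P] (P ⟶ X') ⊗[k] (P ⟶ Y') :=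
  homTensorLift
    (TensorProduct.map (Linear.rightComp k P f) (Linear.rightComp k P g)).toAddMonoidHom
    (fun a b x y => by
      change ((a ≫ x : P ⟶ X) ≫ f) ⊗ₜ[k] ((b ≫ y : P ⟶ Y) ≫ g) =
        (a ≫ x ≫ f : P ⟶ X') ⊗ₜ[k] (b ≫ y ≫ g : P ⟶ Y')
      rw [Category.assoc, Category.assoc])

theorem homTensorMap_apply {X X' Y Y' : C} (f : X ⟶ X') (g : Y ⟶ Y')
    (z : (P ⟶ X) ⊗[k] (P ⟶ Y)) :
    homTensorMap k P f g z =
      TensorProduct.map (Linear.rightComp k P f) (Linear.rightComp k P g) z := rfl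

@[simp]
theorem homTensorMap_tmul {X X' Y Y' : C} (f : X ⟶ X') (g : Y ⟶ Y') (x : P ⟶ X) (y : P ⟶ Y) :
    homTensorMap k P f g (x ⊗ₜ[k] y) = (x ≫ f) ⊗ₜ[k] (y ≫ g) := rfl

theorem homTensorMap_id (X Y : C) : homTensorMap k P (𝟙 X) (𝟙 Y) = LinearMap.id :=
  homTensor_hom_ext fun x y => by simp

theorem homTensorMap_comp {X X' X'' Y Y' Y'' : C} (f : X ⟶ X') (f' : X' ⟶ X'') (g : Y ⟶ Y')
    (g' : Y' ⟶ Y'') : homTensorMap k P (f ≫ f') (g ≫ g') =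
      (homTensorMap k P f' g').comp (homTensorMap k P f g) :=
  homTensor_hom_ext fun x y => by simp

/-- The bifunctor `(X, Y) ↦ Hom(P, X) ⊗ Hom(P, Y)` with values in modules over
`(End P)ᵒᵖ ⊗ (End P)ᵒᵖ`. -/
noncomputable def homTensor : C ⥤ C ⥤ ModuleCat.{v} (EndOpTensor k P) where
  obj X :=
    { obj := fun Y => ModuleCat.of _ ((P ⟶ X) ⊗[k] (P ⟶ Y))
      map := fun g => ModuleCat.ofHom (homTensorMap k P (𝟙 X) g)
      map_id := fun Y => congrArg ModuleCat.ofHom (homTensorMap_id k P X Y)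
      map_comp := fun f g => (congrArg ModuleCat.ofHom (by
        rw [← homTensorMap_comp, Category.comp_id])).trans (ModuleCat.ofHom_comp _ _) }
  map f :=
    { app := fun Y => ModuleCat.ofHom (homTensorMap k P f (𝟙 Y))
      naturality := fun Y Y' g => congrArg ModuleCat.ofHom (show
        (homTensorMap k P f (𝟙 Y')).comp (homTensorMap k P (𝟙 _) g) =
          (homTensorMap k P (𝟙 _) g).comp (homTensorMap k P f (𝟙 Y)) by
        rw [← homTensorMap_comp, ← homTensorMap_comp]
        simp only [Category.comp_id, Category.id_comp]) }
  map_id X := by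
    ext1
    ext1 Y
    exact congrArg ModuleCat.ofHom (homTensorMap_id k P X Y)
  map_comp f g := by
    ext1
    ext1 Y
    exact congrArg ModuleCat.ofHom (show
      _ = (homTensorMap k P g (𝟙 Y)).comp (homTensorMap k P f (𝟙 Y)) by
        rw [← homTensorMap_comp, Category.comp_id])

variable {P} in
theorem rightComp_exact [Projective P] {S : ShortComplex C} (hS : S.ShortExact) :
    Function.Exact (Linear.rightComp k P S.f) (Linear.rightComp k P S.g) ∧
      Function.Surjective (Linear.rightComp k P S.g) := by
  have := hS.mono_f
  have := hS.epi_g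
  refine ⟨fun y => ⟨fun hy => ⟨hS.exact.lift y hy, hS.exact.lift_f y hy⟩, ?_⟩,
    fun z => ⟨Projective.factorThru z S.g, Projective.factorThru_comp _ _⟩⟩
  rintro ⟨x, rfl⟩
  simp

theorem isLinearRightExact_of_exact {E : Type v} [Ring E] [Algebra k E]
    (F : C ⥤ ModuleCat.{v} E)
    (hadd : ∀ {X Y : C} (f g : X ⟶ Y), (F.map (f + g)).hom = (F.map f).hom + (F.map g).hom)
    (hsmul : ∀ {X Y : C} (r : k) (f : X ⟶ Y) (z : F.obj X),
      (F.map (r • f)).hom z = algebraMap k E r • (F.map f).hom z)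
    (hex : ∀ S : ShortComplex C, S.ShortExact →
      Function.Exact (F.map S.f).hom (F.map S.g).hom ∧ Function.Surjective (F.map S.g).hom) :
    IsLinearRightExact k F := by
  have : F.Additive := ⟨fun {X Y f g} => ModuleCat.hom_ext (hadd f g)⟩
  refine ⟨this, ⟨fun f r => ModuleCat.hom_ext (LinearMap.ext fun z => hsmul r f z)⟩, ?_⟩
  rw [F.preservesFiniteColimits_iff_forall_exact_map_and_epi]
  intro S hS
  obtain ⟨h1, h2⟩ := hex S hS
  exact ⟨(ShortComplex.moduleCat_exact_iff _).2 fun x hx => (h1 x).1 hx,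
    (ModuleCat.epi_iff_surjective _).2 h2⟩

/-- `Hom(P, -)` is exact since `P` is projective, and tensoring over `k` is right exact. -/
theorem isBilinearRightExact_homTensor [Projective P] :
    IsBilinearRightExact k (homTensor k P) := by
  refine ⟨fun Y => isLinearRightExact_of_exact k _ (fun {X X'} f g => ?_)
    (fun {X X'} r f z => ?_) fun S hS => ?_,
    fun Y => isLinearRightExact_of_exact k _ (fun {X X'} f g => ?_)
    (fun {X X'} r f z => ?_) fun S hS => ?_⟩
  · change homTensorMap k P (f + g) (𝟙 Y) = homTensorMap k P f (𝟙 Y) + homTensorMap k P g (𝟙 Y)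
    exact homTensor_hom_ext fun x y => by simp [TensorProduct.add_tmul]
  · change (P ⟶ X) ⊗[k] (P ⟶ Y) at z
    refine Eq.trans ?_ (homTensor_algebraMap_smul k P r (homTensorMap k P f (𝟙 Y) z)).symm
    change homTensorMap k P (r • f) (𝟙 Y) z = _
    induction z using TensorProduct.induction_on with
    | zero => simp
    | add z z' hz hz' => rw [map_add, map_add, smul_add, hz, hz']
    | tmul x y => simp [TensorProduct.smul_tmul']
  · obtain ⟨h1, h2⟩ := rightComp_exact (P := P) k hS
    have e {X X' : C} (f : X ⟶ X') : ⇑(homTensorMap k P f (𝟙 Y)) =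
        ⇑(LinearMap.rTensor (P ⟶ Y) (Linear.rightComp k P f)) := by
      funext z
      rw [homTensorMap_apply, LinearMap.rTensor]
      congr 2
      ext y
      simp
    change Function.Exact (homTensorMap k P S.f (𝟙 Y)) (homTensorMap k P S.g (𝟙 Y)) ∧
      Function.Surjective (homTensorMap k P S.g (𝟙 Y))
    rw [e, e]
    exact ⟨rTensor_exact _ h1 h2, LinearMap.rTensor_surjective _ h2⟩
  · change homTensorMap k P (𝟙 Y) (f + g) = homTensorMap k P (𝟙 Y) f + homTensorMap k P (𝟙 Y) g
    exact homTensor_hom_ext fun x y => by simp [TensorProduct.tmul_add]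
  · change (P ⟶ Y) ⊗[k] (P ⟶ X) at z
    refine Eq.trans ?_ (homTensor_algebraMap_smul k P r (homTensorMap k P (𝟙 Y) f z)).symm
    change homTensorMap k P (𝟙 Y) (r • f) z = _
    induction z using TensorProduct.induction_on with
    | zero => simp
    | add z z' hz hz' => rw [map_add, map_add, smul_add, hz, hz']
    | tmul x y => simp
  · obtain ⟨h1, h2⟩ := rightComp_exact (P := P) k hS
    have e {X X' : C} (f : X ⟶ X') : ⇑(homTensorMap k P (𝟙 Y) f) =
        ⇑(LinearMap.lTensor (P ⟶ Y) (Linear.rightComp k P f)) := by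
      funext z
      rw [homTensorMap_apply, LinearMap.lTensor]
      congr 2
      ext y
      simp
    change Function.Exact (homTensorMap k P (𝟙 Y) S.f) (homTensorMap k P (𝟙 Y) S.g) ∧
      Function.Surjective (homTensorMap k P (𝟙 Y) S.g)
    rw [e, e]
    exact ⟨lTensor_exact _ h1 h2, LinearMap.lTensor_surjective _ h2⟩

/-- The module `Hom(P, P) ⊗ Hom(P, P)` is free of rank one, generated by `1 ⊗ 1`. -/
noncomputable def homTensorSelf :
    EndOpTensor k P ≃ₗ[EndOpTensor k P] (P ⟶ P) ⊗[k] (P ⟶ P) :=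
  LinearEquiv.ofBijective (LinearMap.toSpanSingleton _ _ (𝟙 P ⊗ₜ[k] 𝟙 P)) (by
    -- Acting on `1 ⊗ 1` merely removes `op` in both factors, which is visibly bijective.
    let e : EndOpTensor k P ≃ₗ[k] (End P) ⊗[k] (End P) :=
      TensorProduct.congr (MulOpposite.opLinearEquiv k (M := End P)).symm
        (MulOpposite.opLinearEquiv k (M := End P)).symm
    suffices h : ∀ z : EndOpTensor k P,
        (z • (𝟙 P ⊗ₜ[k] 𝟙 P) : (P ⟶ P) ⊗[k] (P ⟶ P)) = e z from
      (funext h : ⇑(LinearMap.toSpanSingleton (EndOpTensor k P)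
        ((P ⟶ P) ⊗[k] (P ⟶ P)) (𝟙 P ⊗ₜ[k] 𝟙 P)) = ⇑e) ▸ e.bijective
    intro z
    induction z using TensorProduct.induction_on with
    | zero => exact (zero_smul (EndOpTensor k P) (𝟙 P ⊗ₜ[k] 𝟙 P :
        (P ⟶ P) ⊗[k] (P ⟶ P))).trans e.map_zero.symm
    | add z z' hz hz' => rw [add_smul, map_add, hz, hz']
    | tmul x y =>
      rw [homTensor_smul_tmul, Category.comp_id, Category.comp_id]
      rfl)

theorem homTensorSelf_one : homTensorSelf k P 1 = 𝟙 P ⊗ₜ[k] 𝟙 P :=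
  one_smul (EndOpTensor k P) (𝟙 P ⊗ₜ[k] 𝟙 P : (P ⟶ P) ⊗[k] (P ⟶ P))

end HomTensor

/-! ### Finite-dimensionality of all Hom spaces. -/

section Finite

variable {k : Type w} [Field k] {C : Type u} [Category.{v} C] [Abelian C] [Linear k C]

theorem finiteDimensional_hom_of_epi_biproduct {P X Y : C} [FiniteDimensional k (P ⟶ Y)]
    {m : ℕ} (s : (⨁ fun _ : Fin m => P) ⟶ X) [Epi s] : FiniteDimensional k (X ⟶ Y) := by
  let L : (X ⟶ Y) →ₗ[k] (Fin m → (P ⟶ Y)) :=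
    LinearMap.pi fun i => Linear.leftComp k Y (biproduct.ι (fun _ : Fin m => P) i ≫ s)
  refine FiniteDimensional.of_injective L ((injective_iff_map_eq_zero _).2 fun f hf => ?_)
  rw [← cancel_epi s, comp_zero]
  apply biproduct.hom_ext'
  intro i
  simpa [L] using congrFun hf i

/-- For a cover `P^m ⟶ Y`, projectivity makes `Hom(P, Y)` a quotient of `(End P)^m`; a cover of `X`
then embeds `Hom(X, Y)` into a power of `Hom(P, Y)`. -/
theorem SatisfiesPF.finiteDimensional_hom (h : SatisfiesPF k C) (X Y : C) :
    FiniteDimensional k (X ⟶ Y) := by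
  obtain ⟨P, ⟨hP, hgen⟩, hfin⟩ := h
  have : FiniteDimensional k (P ⟶ Y) := by
    obtain ⟨m, s, hs⟩ := hgen Y
    let L : (Fin m → (P ⟶ P)) →ₗ[k] (P ⟶ Y) :=
      ∑ i, (Linear.rightComp k P (biproduct.ι (fun _ : Fin m => P) i ≫ s)).comp
        (LinearMap.proj i)
    refine Module.Finite.of_surjective L fun f => ?_
    refine ⟨fun i => Projective.factorThru f s ≫ biproduct.π (fun _ : Fin m => P) i, ?_⟩
    have : L (fun i => Projective.factorThru f s ≫ biproduct.π (fun _ : Fin m => P) i) =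
        Projective.factorThru f s ≫ (∑ i, biproduct.π (fun _ : Fin m => P) i ≫
          biproduct.ι (fun _ : Fin m => P) i) ≫ s := by
      rw [Preadditive.sum_comp, Preadditive.comp_sum]
      simp [L]
    rw [this, biproduct.total, Category.id_comp, Projective.factorThru_comp]
  obtain ⟨m, s, hs⟩ := hgen X
  exact finiteDimensional_hom_of_epi_biproduct s

end Finite

/-! ### Finiteness over `(End P)ᵒᵖ ⊗ (End P)ᵒᵖ`. -/

section FiniteHomTensor

open TensorProduct

variable (k : Type w) [Field k] {C : Type u} [Category.{v} C] [Abelian C] [Linear k C] (P : C)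
  (hfin : ∀ X Y : C, FiniteDimensional k (X ⟶ Y))

include hfin

theorem finite_endOpTensor : Module.Finite k (EndOpTensor k P) := by
  have : Module.Finite k (End P) := hfin P P
  have : Module.Finite k (End P)ᵐᵒᵖ := Module.Finite.equiv (MulOpposite.opLinearEquiv k)
  infer_instance

/-- This makes the finitely generated modules an abelian category, hence a legitimate test category
for the universal property. -/
theorem isNoetherianRing_endOpTensor : IsNoetherianRing (EndOpTensor k P) :=
  have := finite_endOpTensor k P hfin
  isNoetherian_of_tower k inferInstance

theorem finite_homTensor (X Y : C) :
    Module.Finite (EndOpTensor k P) ((P ⟶ X) ⊗[k] (P ⟶ Y)) :=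
  have := hfin P X
  have := hfin P Y
  Module.Finite.of_restrictScalars_finite k _ _

end FiniteHomTensor

/-! ### Partial left adjoints composed with right exact functors. -/

section PartialAdjoint

universe v₁ u₁ v₂ u₂ v₃ u₃

namespace CategoryTheory.Functor

variable {A' : Type u₂} [Category.{v₂} A'] {D : Type u₃} [Category.{v₃} D] {K : D ⥤ A'}

variable {Γ : D ⥤ A'} (hΓ : ∀ Z, K.leftAdjointObjIsDefined (Γ.obj Z))

/-- The composition of a functor `Γ` with the partial left adjoint of `K`, if it is defined on
the image of `Γ`. -/
noncomputable def compPartialLeftAdjoint : D ⥤ D :=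
  ObjectProperty.lift _ Γ hΓ ⋙ K.partialLeftAdjoint

/-- The adjunction bijection for `compPartialLeftAdjoint`. -/
noncomputable def compPartialLeftAdjointHomEquiv {Z W : D} :
    ((compPartialLeftAdjoint hΓ).obj Z ⟶ W) ≃ (Γ.obj Z ⟶ K.obj W) :=
  K.partialLeftAdjointHomEquiv (X := ⟨Γ.obj Z, hΓ Z⟩)

theorem compPartialLeftAdjointHomEquiv_comp {Z W W' : D}
    (f : (compPartialLeftAdjoint hΓ).obj Z ⟶ W) (g : W ⟶ W') :
    compPartialLeftAdjointHomEquiv hΓ (f ≫ g) =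
      compPartialLeftAdjointHomEquiv hΓ f ≫ K.map g :=
  K.partialLeftAdjointHomEquiv_comp f g

theorem compPartialLeftAdjointHomEquiv_map_comp {Z Z' W : D} (f : Z ⟶ Z')
    (g : (compPartialLeftAdjoint hΓ).obj Z' ⟶ W) :
    compPartialLeftAdjointHomEquiv hΓ ((compPartialLeftAdjoint hΓ).map f ≫ g) =
      Γ.map f ≫ compPartialLeftAdjointHomEquiv hΓ g :=
  K.partialLeftAdjointHomEquiv_map_comp (X := ⟨Γ.obj Z, hΓ Z⟩) (X' := ⟨Γ.obj Z', hΓ Z'⟩)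
    ((ObjectProperty.lift _ Γ hΓ).map f) g

theorem compPartialLeftAdjointHomEquiv_map {Z Z' : D} (f : Z ⟶ Z') :
    compPartialLeftAdjointHomEquiv hΓ ((compPartialLeftAdjoint hΓ).map f) =
      Γ.map f ≫ compPartialLeftAdjointHomEquiv hΓ (𝟙 _) := by
  rw [← compPartialLeftAdjointHomEquiv_map_comp, Category.comp_id]

theorem compPartialLeftAdjointHomEquiv_eq {Z W : D}
    (f : (compPartialLeftAdjoint hΓ).obj Z ⟶ W) :
    compPartialLeftAdjointHomEquiv hΓ f =
      compPartialLeftAdjointHomEquiv hΓ (𝟙 _) ≫ K.map f := by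
  rw [← compPartialLeftAdjointHomEquiv_comp, Category.id_comp]

variable [Abelian A'] [Abelian D]

/-- If the partial left adjoint of `K` is defined at the image of a generator under a right exact
functor `j`, then it is defined on the whole image of `j`. -/
theorem leftAdjointObjIsDefined_of_generator {A : Type u₁} [Category.{v₁} A] [Abelian A]
    (K : D ⥤ A') (j : A ⥤ A') [j.Additive]
    [PreservesFiniteColimits j] {P : A}
    (hP : ∀ U : A, ∃ (m : ℕ) (s : (⨁ fun _ : Fin m => P) ⟶ U), Epi s)
    (h : K.leftAdjointObjIsDefined (j.obj P)) (U : A) :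
    K.leftAdjointObjIsDefined (j.obj U) := by
  have h₀ (m : ℕ) : K.leftAdjointObjIsDefined (j.obj (⨁ fun _ : Fin m => P)) :=
    leftAdjointObjIsDefined_of_isColimit
      (isColimitOfPreserves j (biproduct.isColimit fun _ : Fin m => P)) fun _ => h
  obtain ⟨m, s, hs⟩ := hP U
  obtain ⟨n, q, hq⟩ := hP (Limits.kernel s)
  -- Covering the kernel as well gives a presentation `P^n ⟶ P^m ⟶ U ⟶ 0`; the domain of a partial
  -- left adjoint is closed under the colimits that `D` has.
  have hc := isCokernelEpiComp (Abelian.epiIsCokernelOfKernel _ (kernelIsKernel s)) q rfl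
  refine leftAdjointObjIsDefined_of_isColimit (isColimitOfPreserves j hc) ?_
  rintro (_ | _)
  exacts [h₀ n, h₀ m]

theorem compPartialLeftAdjointHomEquiv_add [K.Additive] {Z W : D}
    (f g : (compPartialLeftAdjoint hΓ).obj Z ⟶ W) :
    compPartialLeftAdjointHomEquiv hΓ (f + g) =
      compPartialLeftAdjointHomEquiv hΓ f + compPartialLeftAdjointHomEquiv hΓ g := by
  rw [compPartialLeftAdjointHomEquiv_eq, K.map_add, Preadditive.comp_add,
    ← compPartialLeftAdjointHomEquiv_eq, ← compPartialLeftAdjointHomEquiv_eq]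

theorem compPartialLeftAdjointHomEquiv_zero [K.Additive] (Z W : D) :
    compPartialLeftAdjointHomEquiv hΓ (0 : (compPartialLeftAdjoint hΓ).obj Z ⟶ W) = 0 := by
  rw [compPartialLeftAdjointHomEquiv_eq, K.map_zero, comp_zero]

instance additive_compPartialLeftAdjoint [K.Additive] [Γ.Additive] :
    (compPartialLeftAdjoint hΓ).Additive where
  map_add {X Y f g} := by
    apply (compPartialLeftAdjointHomEquiv hΓ).injective
    rw [compPartialLeftAdjointHomEquiv_add, compPartialLeftAdjointHomEquiv_map,
      compPartialLeftAdjointHomEquiv_map, compPartialLeftAdjointHomEquiv_map, Γ.map_add,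
      Preadditive.add_comp]

theorem linear_compPartialLeftAdjoint (k : Type w) [Field k] [CategoryTheory.Linear k D]
    [CategoryTheory.Linear k A']
    [K.Linear k] [Γ.Linear k] : (compPartialLeftAdjoint hΓ).Linear k where
  map_smul {X Y} f r := by
    apply (compPartialLeftAdjointHomEquiv hΓ).injective
    rw [compPartialLeftAdjointHomEquiv_map, Γ.map_smul,
      compPartialLeftAdjointHomEquiv_eq hΓ (r • _), K.map_smul,
      CategoryTheory.Linear.comp_smul, ← compPartialLeftAdjointHomEquiv_eq,
      compPartialLeftAdjointHomEquiv_map, CategoryTheory.Linear.smul_comp]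

/-- A cokernel is tested by maps out of it, and these correspond to maps from `Γ Z` to `K W`. So
right exactness of `Γ` suffices and `K` need only be additive. -/
theorem preservesFiniteColimits_compPartialLeftAdjoint [K.Additive] [Γ.Additive]
    [PreservesFiniteColimits Γ] : PreservesFiniteColimits (compPartialLeftAdjoint hΓ) := by
  rw [(compPartialLeftAdjoint hΓ).preservesFiniteColimits_iff_forall_exact_map_and_epi]
  intro T hT
  obtain ⟨hex, hepi⟩ :=
    (Γ.preservesFiniteColimits_iff_forall_exact_map_and_epi).1 inferInstance T hT
  have : Epi (T.map Γ).g := hepi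
  have key {W : D} (f : (compPartialLeftAdjoint hΓ).obj T.X₂ ⟶ W)
      (hf : (compPartialLeftAdjoint hΓ).map T.f ≫ f = 0) :
      ∃ q : (compPartialLeftAdjoint hΓ).obj T.X₃ ⟶ W,
        (compPartialLeftAdjoint hΓ).map T.g ≫ q = f := by
    have hz : Γ.map T.f ≫ compPartialLeftAdjointHomEquiv hΓ f = 0 := by
      rw [← compPartialLeftAdjointHomEquiv_map_comp, hf, compPartialLeftAdjointHomEquiv_zero]
    obtain ⟨p, hp⟩ : ∃ p : Γ.obj T.X₃ ⟶ K.obj W,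
        Γ.map T.g ≫ p = compPartialLeftAdjointHomEquiv hΓ f :=
      ⟨hex.desc _ hz, hex.g_desc _ hz⟩
    refine ⟨(compPartialLeftAdjointHomEquiv hΓ).symm p,
      (compPartialLeftAdjointHomEquiv hΓ).injective ?_⟩
    rw [compPartialLeftAdjointHomEquiv_map_comp, Equiv.apply_symm_apply, hp]
  have epi : Epi ((compPartialLeftAdjoint hΓ).map T.g) := by
    refine Preadditive.epi_of_cancel_zero _ fun {W} f hf => ?_
    apply (compPartialLeftAdjointHomEquiv hΓ).injective
    rw [compPartialLeftAdjointHomEquiv_zero, ← cancel_epi (Γ.map T.g), comp_zero,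
      ← compPartialLeftAdjointHomEquiv_map_comp, hf, compPartialLeftAdjointHomEquiv_zero]
  refine ⟨ShortComplex.exact_of_g_is_cokernel _ (CokernelCofork.IsColimit.ofπ _ _
    (fun f hf => (key f hf).choose) (fun f hf => (key f hf).choose_spec) fun f hf q hq => ?_), epi⟩
  exact (cancel_epi ((compPartialLeftAdjoint hΓ).map T.g)).1
    (hq.trans (key f hf).choose_spec.symm)

end CategoryTheory.Functor

end PartialAdjoint

/-! ### Finitely generated modules and the free module of rank one. -/

section FG

variable {E : Type v} [Ring E]

theorem hom_eq_of_apply_one_eq {M N : ModuleCat.{v} E} (e : E ≃ₗ[E] M) {φ ψ : M ⟶ N}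
    (h : φ.hom (e 1) = ψ.hom (e 1)) : φ = ψ := by
  refine ModuleCat.hom_ext ?_
  have : φ.hom.comp e.toLinearMap = ψ.hom.comp e.toLinearMap := LinearMap.ext_ring h
  ext x
  simpa using LinearMap.congr_fun this (e.symm x)

theorem exists_hom_apply_one_eq {M N : ModuleCat.{v} E} (e : E ≃ₗ[E] M) (n : N) :
    ∃ φ : M ⟶ N, φ.hom (e 1) = n :=
  ⟨ModuleCat.ofHom ((LinearMap.toSpanSingleton E N n).comp e.symm.toLinearMap), by simp⟩

/-- If `M` is free of rank one over `E`, then finitely many morphisms from `M` to a finitely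
generated module `U` are jointly surjective. -/
theorem exists_jointly_epi_FGModuleCat {M : ModuleCat.{v} E} (e : E ≃ₗ[E] M)
    (U : FGModuleCat.{v} E) : ∃ (m : ℕ) (g : Fin m → (M ⟶ U.obj)),
      ∀ {N : ModuleCat.{v} E} (h : U.obj ⟶ N), (∀ i, g i ≫ h = 0) → h = 0 := by
  obtain ⟨m, s, hs⟩ := Module.Finite.exists_fin (R := E) (M := U.obj)
  choose g hg using fun i => exists_hom_apply_one_eq e (s i)
  refine ⟨m, g, fun {N} h hh => ?_⟩
  refine ModuleCat.hom_ext (LinearMap.ext_on_range hs fun i => ?_)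
  have := congrArg (fun q : M ⟶ N => q.hom (e 1)) (hh i)
  simpa [hg] using this

variable (k : Type w) [Field k] [Algebra k E] [IsNoetherianRing E]

instance : PreservesFiniteColimits (ModuleCat.isFG.{v} E).ι :=
  inferInstanceAs (PreservesFiniteColimits (forget₂ (FGModuleCat.{v} E) (ModuleCat.{v} E)))

theorem isLinearRightExact_FGModuleCat_ι : IsLinearRightExact k (ModuleCat.isFG.{v} E).ι :=
  ⟨inferInstance, ⟨fun _ _ => rfl⟩, inferInstance⟩

variable {k} in
-- The inclusion into all modules is fully faithful, so it reflects colimits and linear identities.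
theorem isLinearRightExact_of_comp_FGModuleCat_ι {C : Type u} [Category.{v} C] [Abelian C]
    [Linear k C] {F : C ⥤ FGModuleCat.{v} E}
    (h : IsLinearRightExact k (F ⋙ (ModuleCat.isFG.{v} E).ι)) : IsLinearRightExact k F := by
  obtain ⟨h1, h2, h3⟩ := h
  have h4 : F.Additive := ⟨fun {X Y f g} => (ModuleCat.isFG.{v} E).ι.map_injective
    ((F ⋙ (ModuleCat.isFG.{v} E).ι).map_add (f := f) (g := g))⟩
  refine ⟨h4, ⟨fun f r => ?_⟩, ?_⟩
  · apply (ModuleCat.isFG.{v} E).ι.map_injective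
    exact (F ⋙ (ModuleCat.isFG.{v} E).ι).map_smul r f
  · have : ReflectsFiniteColimits (ModuleCat.isFG.{v} E).ι := by constructor
    exact preservesFiniteColimits_of_reflects_of_preserves F (ModuleCat.isFG.{v} E).ι

theorem exists_epi_FGModuleCat {M : FGModuleCat.{v} E} (e : E ≃ₗ[E] M.obj)
    (U : FGModuleCat.{v} E) : ∃ (m : ℕ) (s : (⨁ fun _ : Fin m => M) ⟶ U), Epi s := by
  obtain ⟨m, g, hg⟩ := exists_jointly_epi_FGModuleCat e U
  refine ⟨m, biproduct.desc fun i => ObjectProperty.homMk (g i),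
    Preadditive.epi_of_cancel_zero _ fun {N} f hf => ?_⟩
  apply (ModuleCat.isFG.{v} E).ι.map_injective
  rw [Functor.map_zero]
  refine hg _ fun i => ?_
  have := congrArg (fun q => (biproduct.ι (fun _ : Fin m => M) i ≫ q).hom) hf
  simpa using this

end FG

/-! ### Transferring generator properties from modules to `D`. -/

section Comparison

variable {k : Type w} [Field k] {E : Type v} [Ring E] [Algebra k E] [IsNoetherianRing E]
  {D : Type u} [Category.{v} D] [Abelian D] [Linear k D]

/-- Let `G : D ⥤ mod E` be right exact with a natural transformation to a functor `K` which
exhibits every object `Z` of `D` as a left adjoint object of `G Z`.  If `G Q` is free of rank one,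
then `Q` is a projective generator and has finite dimensional Hom spaces to all objects. -/
theorem isProjectiveGenerator_of_comparison {G : D ⥤ FGModuleCat.{v} E}
    (hG : IsLinearRightExact k G) {K : D ⥤ ModuleCat.{v} E}
    (θ : G ⋙ (ModuleCat.isFG.{v} E).ι ⟶ K)
    (hθ : ∀ Z W : D, Function.Bijective fun h : Z ⟶ W => θ.app Z ≫ K.map h)
    {Q : D} (e : E ≃ₗ[E] (G.obj Q).obj) [Module.Finite k E] :
    IsProjectiveGenerator Q ∧ ∀ Z : D, FiniteDimensional k (Q ⟶ Z) := by
  obtain ⟨h1, h2, h3⟩ := hG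
  have nat {Z W : D} (h : Z ⟶ W) : (G.map h).hom ≫ θ.app W = θ.app Z ≫ K.map h := θ.naturality h
  have faithful {Z W : D} {h h' : Z ⟶ W} (hh : G.map h = G.map h') : h = h' := by
    apply (hθ Z W).1
    simp only [← nat, hh]
  refine ⟨⟨⟨fun {Z Z''} f p hp => ?_⟩, fun Z => ?_⟩, fun Z => ?_⟩
  · have hsurj : Function.Surjective (G.map p).hom.hom :=
      (ModuleCat.epi_iff_surjective _).1
        (inferInstanceAs (Epi ((G ⋙ (ModuleCat.isFG.{v} E).ι).map p)))
    obtain ⟨z, hz⟩ := hsurj ((G.map f).hom.hom (e 1))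
    obtain ⟨g, hg⟩ := exists_hom_apply_one_eq e z
    -- `G` is not known to be full, so `g` need not be `G.map q`; agreement after `θ` is enough, as
    -- `θ` detects morphisms of `D`.
    obtain ⟨q, hq⟩ := (hθ Q Z).2 (g ≫ θ.app Z)
    refine ⟨q, (hθ Q Z'').1 ?_⟩
    have hg' : g ≫ (G.map p).hom = (G.map f).hom :=
      hom_eq_of_apply_one_eq e (by simp [hg, hz])
    change θ.app Q ≫ K.map (q ≫ p) = θ.app Q ≫ K.map f
    change θ.app Q ≫ K.map q = _ at hq
    rw [K.map_comp, reassoc_of% hq, ← nat, ← nat, reassoc_of% hg']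
  · obtain ⟨m, g, hg⟩ := exists_jointly_epi_FGModuleCat e (G.obj Z)
    choose q hq using fun i => (hθ Q Z).2 (g i ≫ θ.app Z)
    refine ⟨m, biproduct.desc q, Preadditive.epi_of_cancel_zero _ fun {W} h hh => ?_⟩
    have hqh (i : Fin m) : q i ≫ h = 0 := by
      simpa using congrArg (fun x => biproduct.ι (fun _ : Fin m => Q) i ≫ x) hh
    apply (hθ Z W).1
    have h0 : θ.app Z ≫ K.map h = 0 := hg _ fun i => by
      have hqi : θ.app Q ≫ K.map (q i) = g i ≫ θ.app Z := hq i
      rw [← reassoc_of% hqi, ← K.map_comp, hqh, ← nat, G.map_zero]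
      exact zero_comp
    have h0' : θ.app Z ≫ K.map (0 : Z ⟶ W) = 0 := by
      rw [← nat, G.map_zero]
      exact zero_comp
    exact h0.trans h0'.symm
  -- As `G` is faithful and `G Q` is free on `e 1`, evaluation at `e 1` embeds `Hom(Q, Z)` into the
  -- finite-dimensional space `G Z`.
  · let _ : Module k (G.obj Z).obj := Module.compHom _ (algebraMap k E)
    have : IsScalarTower k E (G.obj Z).obj := IsScalarTower.of_algebraMap_smul fun _ _ => rfl
    have : Module.Finite k (G.obj Z).obj := Module.Finite.trans E _
    let L : (Q ⟶ Z) →ₗ[k] (G.obj Z).obj :=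
      { toFun := fun f => (G.map f).hom.hom (e 1)
        map_add' := fun f g => by rw [G.map_add]; rfl
        map_smul' := fun r f => by rw [G.map_smul]; rfl }
    refine FiniteDimensional.of_injective L fun f g hfg => ?_
    exact faithful (ObjectProperty.hom_ext _ (hom_eq_of_apply_one_eq e hfg))

end Comparison

/-! ### `Hom(Q, -)` as a module-valued functor. -/

section EndFunctor

variable {k : Type w} [Field k]

/-- The algebra homomorphism `End X → End (F X)` of a linear functor `F`. -/
def endAlgHom {C : Type u} [Category.{v} C] [Preadditive C] [Linear k C]
    {D : Type u'} [Category.{v} D] [Preadditive D] [Linear k D]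
    (F : C ⥤ D) [F.Additive] [F.Linear k] (X : C) : End X →ₐ[k] End (F.obj X) :=
  AlgHom.ofLinearMap (F.mapLinearMap k : (X ⟶ X) →ₗ[k] (F.obj X ⟶ F.obj X)) (F.map_id X)
    fun f g => F.map_comp g f

variable {D : Type u} [Category.{v} D] [Abelian D] [Linear k D]
  {E : Type v} [Ring E] [Algebra k E] {Q : D} (φ : E →ₐ[k] (End Q)ᵐᵒᵖ)

/-- The functor `Hom(Q, -)` with values in modules over an algebra acting on `Q`. -/
noncomputable def homFunctor : D ⥤ ModuleCat.{v} E :=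
  preadditiveCoyonedaObj Q ⋙ ModuleCat.restrictScalars φ.toRingHom

instance : (homFunctor φ).Additive :=
  ⟨fun {_ _ f g} => ModuleCat.hom_ext (LinearMap.ext fun (x : Q ⟶ _) =>
    Preadditive.comp_add _ _ _ x f g)⟩

theorem homFunctor_smul {Z : D} (e : E) (x : Q ⟶ Z) :
    (e • (show (homFunctor φ).obj Z from x) : (homFunctor φ).obj Z) = (φ e).unop ≫ x := rfl

instance : (homFunctor φ).Linear k where
  map_smul {Z W} f r := ModuleCat.hom_ext (LinearMap.ext fun (x : Q ⟶ _) => by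
    change x ≫ (r • f) = (φ (algebraMap k E r)).unop ≫ (x ≫ f)
    rw [AlgHom.commutes, Linear.comp_smul]
    change _ = (r • 𝟙 Q) ≫ x ≫ f
    rw [Linear.smul_comp, Category.id_comp])

end EndFunctor

/-! ### Comparing `Hom(P, X) ⊗ Hom(P, Y)` with `Hom(P ⊠ P, X ⊠ Y)`. -/

section Box

open TensorProduct

variable {k : Type w} [Field k] {C : Type u} [Category.{v} C] {D : Type u'} [Category.{v} D]
  {box : C ⥤ C ⥤ D}

variable (box) in
/-- The morphism `x ⊠ y`. -/
def boxMap {X X' Y Y' : C} (x : X ⟶ X') (y : Y ⟶ Y') :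
    (box.obj X).obj Y ⟶ (box.obj X').obj Y' :=
  (box.map x).app Y ≫ (box.obj X').map y

theorem boxMap_comp {X X' X'' Y Y' Y'' : C} (x : X ⟶ X') (x' : X' ⟶ X'') (y : Y ⟶ Y')
    (y' : Y' ⟶ Y'') : boxMap box (x ≫ x') (y ≫ y') = boxMap box x y ≫ boxMap box x' y' := by
  simp [boxMap]

theorem boxMap_id (X Y : C) : boxMap box (𝟙 X) (𝟙 Y) = 𝟙 _ := by
  simp [boxMap]

theorem boxMap_id_right {X X' : C} (x : X ⟶ X') (Y : C) :
    boxMap box x (𝟙 Y) = (box.map x).app Y := by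
  simp [boxMap]

theorem boxMap_id_left (X : C) {Y Y' : C} (y : Y ⟶ Y') :
    boxMap box (𝟙 X) y = (box.obj X).map y := by
  simp [boxMap]

variable [Abelian C] [Linear k C] [Abelian D] [Linear k D] (hbox : IsBilinearRightExact k box)

include hbox

/-- `(x, y) ↦ x ⊠ y` as a linear map on the tensor product. -/
def boxLinearMap (X X' Y Y' : C) :
    (X ⟶ X') ⊗[k] (Y ⟶ Y') →ₗ[k] ((box.obj X).obj Y ⟶ (box.obj X').obj Y') :=
  have := (hbox.left Y).additive
  have := (hbox.left Y).linear
  have := (hbox.right X').additive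
  have := (hbox.right X').linear
  TensorProduct.lift (LinearMap.mk₂ k (boxMap box)
    (fun x x' y => by
      have : (box.map (x + x')).app Y = (box.map x).app Y + (box.map x').app Y :=
        (box.flip.obj Y).map_add
      rw [boxMap, this, Preadditive.add_comp]; rfl)
    (fun r x y => by
      have : (box.map (r • x)).app Y = r • (box.map x).app Y := (box.flip.obj Y).map_smul r x
      rw [boxMap, this, Linear.smul_comp]; rfl)
    (fun x y y' => by rw [boxMap, Functor.map_add, Preadditive.comp_add]; rfl)
    (fun r x y => by rw [boxMap, Functor.map_smul, Linear.comp_smul]; rfl))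

@[simp]
theorem boxLinearMap_tmul {X X' Y Y' : C} (x : X ⟶ X') (y : Y ⟶ Y') :
    boxLinearMap hbox X X' Y Y' (x ⊗ₜ[k] y) = boxMap box x y := by
  simp [boxLinearMap]

variable (P : C)

/-- The left action of `(End P)ᵒᵖ` on `P ⊠ P`. -/
def boxActionLeft : (End P)ᵐᵒᵖ →ₐ[k] (End ((box.obj P).obj P))ᵐᵒᵖ :=
  have := (hbox.left P).additive
  have := (hbox.left P).linear
  (endAlgHom (k := k) (box.flip.obj P) P).op

/-- The right action of `(End P)ᵒᵖ` on `P ⊠ P`. -/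
def boxActionRight : (End P)ᵐᵒᵖ →ₐ[k] (End ((box.obj P).obj P))ᵐᵒᵖ :=
  have := (hbox.right P).additive
  have := (hbox.right P).linear
  (endAlgHom (k := k) (box.obj P) P).op

/-- The interchange law for `⊠`, that is, naturality of `box.map a`. -/
theorem commute_boxAction (a b : (End P)ᵐᵒᵖ) :
    Commute (boxActionLeft hbox P a) (boxActionRight hbox P b) :=
  congrArg MulOpposite.op ((box.map a.unop).naturality b.unop).symm

/-- The action of `(End P)ᵒᵖ ⊗ (End P)ᵒᵖ` on `P ⊠ P`. -/
noncomputable def boxAction : EndOpTensor k P →ₐ[k] (End ((box.obj P).obj P))ᵐᵒᵖ :=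
  Algebra.TensorProduct.lift (boxActionLeft hbox P) (boxActionRight hbox P)
    (commute_boxAction hbox P)

theorem boxAction_tmul (a b : (End P)ᵐᵒᵖ) :
    (boxAction hbox P (a ⊗ₜ[k] b)).unop = boxMap box (X := P) (Y := P) a.unop b.unop := by
  rw [boxAction, Algebra.TensorProduct.lift_tmul]
  rfl

/-- The functor `Hom(P ⊠ P, -)` with values in modules over `(End P)ᵒᵖ ⊗ (End P)ᵒᵖ`. -/
noncomputable def boxHom : D ⥤ ModuleCat.{v} (EndOpTensor k P) := homFunctor (boxAction hbox P)

instance : (boxHom hbox P).Additive := inferInstanceAs (homFunctor _).Additive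

/-- The linear map `Hom(P, X) ⊗ Hom(P, Y) → Hom(P ⊠ P, X ⊠ Y)`. -/
noncomputable def homTensorToBoxHomLinear (X Y : C) :
    (P ⟶ X) ⊗[k] (P ⟶ Y) →ₗ[EndOpTensor k P] (boxHom hbox P).obj ((box.obj X).obj Y) :=
  homTensorLift (boxLinearMap hbox P X P Y).toAddMonoidHom fun a b x y => by
    refine Eq.trans ?_ (homFunctor_smul (boxAction hbox P)
      (MulOpposite.op a ⊗ₜ[k] MulOpposite.op b) (boxLinearMap hbox P X P Y (x ⊗ₜ[k] y))).symm
    rw [boxLinearMap_tmul, boxAction_tmul, ← boxMap_comp]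
    exact boxLinearMap_tmul hbox (X := P) (Y := P) (a ≫ x) (b ≫ y)

/-- The morphism `Hom(P, X) ⊗ Hom(P, Y) → Hom(P ⊠ P, X ⊠ Y)` of modules. -/
noncomputable def homTensorToBoxHom (X Y : C) :
    ((homTensor k P).obj X).obj Y ⟶ (boxHom hbox P).obj ((box.obj X).obj Y) :=
  ModuleCat.ofHom (Y := (boxHom hbox P).obj ((box.obj X).obj Y)) (homTensorToBoxHomLinear hbox P X Y)

theorem homTensorToBoxHomLinear_tmul {X Y : C} (x : P ⟶ X) (y : P ⟶ Y) :
    homTensorToBoxHomLinear hbox P X Y (x ⊗ₜ[k] y) = boxMap box x y :=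
  boxLinearMap_tmul hbox x y

theorem homTensorToBoxHom_natural_left {X X' : C} (f : X ⟶ X') (Y : C) :
    homTensorToBoxHom hbox P X Y ≫ (boxHom hbox P).map ((box.map f).app Y) =
      ((homTensor k P).map f).app Y ≫ homTensorToBoxHom hbox P X' Y := by
  refine ModuleCat.hom_ext (homTensor_hom_ext fun x y => ?_)
  change homTensorToBoxHomLinear hbox P X Y (x ⊗ₜ[k] y) ≫ (box.map f).app Y =
    homTensorToBoxHomLinear hbox P X' Y ((x ≫ f) ⊗ₜ[k] (y ≫ 𝟙 Y))
  rw [homTensorToBoxHomLinear_tmul, homTensorToBoxHomLinear_tmul, boxMap_comp, boxMap_id_right]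

theorem homTensorToBoxHom_natural_right (X : C) {Y Y' : C} (g : Y ⟶ Y') :
    homTensorToBoxHom hbox P X Y ≫ (boxHom hbox P).map ((box.obj X).map g) =
      ((homTensor k P).obj X).map g ≫ homTensorToBoxHom hbox P X Y' := by
  refine ModuleCat.hom_ext (homTensor_hom_ext fun x y => ?_)
  change homTensorToBoxHomLinear hbox P X Y (x ⊗ₜ[k] y) ≫ (box.obj X).map g =
    homTensorToBoxHomLinear hbox P X Y' ((x ≫ 𝟙 X) ⊗ₜ[k] (y ≫ g))
  rw [homTensorToBoxHomLinear_tmul, homTensorToBoxHomLinear_tmul, boxMap_comp, boxMap_id_left]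

/-- The map `Hom(X ⊠ Y, W) → Hom(Hom(P, X) ⊗ Hom(P, Y), Hom(P ⊠ P, W))`. -/
noncomputable def boxAdjoint (X Y : C) (W : D) : ((box.obj X).obj Y ⟶ W) →+
    (((homTensor k P).obj X).obj Y ⟶ (boxHom hbox P).obj W) where
  toFun f := homTensorToBoxHom hbox P X Y ≫ (boxHom hbox P).map f
  map_zero' := by simp
  map_add' f g := by simp

/-- The source module is free on `1 ⊗ 1`, which the comparison sends to the identity of `P ⊠ P`;
evaluation there is the inverse. -/
theorem bijective_boxAdjoint_self (W : D) : Function.Bijective (boxAdjoint hbox P P P W) := by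
  have key (f : (box.obj P).obj P ⟶ W) :
      (boxAdjoint hbox P P P W f).hom (homTensorSelf k P 1) = f := by
    rw [homTensorSelf_one]
    change homTensorToBoxHomLinear hbox P P P (𝟙 P ⊗ₜ[k] 𝟙 P) ≫ f = f
    rw [homTensorToBoxHomLinear_tmul, boxMap_id, Category.id_comp]
  refine ⟨fun f g h => ?_, fun g => ⟨g.hom (homTensorSelf k P 1), ?_⟩⟩
  · rw [← key f, h, key]
  · refine hom_eq_of_apply_one_eq (M := ((homTensor k P).obj P).obj P)
      (N := (boxHom hbox P).obj W) (homTensorSelf k P) ?_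
    generalize h : g.hom (homTensorSelf k P 1) = f
    exact key f

/-- The generator criterion is applied once per variable, the first time with `P` fixed in the
second slot. -/
theorem bijective_boxAdjoint [Projective P]
    (hP : ∀ U : C, ∃ (m : ℕ) (s : (⨁ fun _ : Fin m => P) ⟶ U), Epi s) (X Y : C) (W : D) :
    Function.Bijective (boxAdjoint hbox P X Y W) := by
  have hM := isBilinearRightExact_homTensor k P
  have h₁ (X : C) : Function.Bijective (boxAdjoint hbox P X P W) := by
    obtain ⟨a1, a2, a3⟩ := hbox.left P
    obtain ⟨b1, b2, b3⟩ := hM.left P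
    refine bijective_of_bijective_generator (box.flip.obj P) ((homTensor k P).flip.obj P)
      (fun X => boxAdjoint hbox P X P W) (fun {X X'} f g => ?_) hP
      (bijective_boxAdjoint_self hbox P W) X
    change homTensorToBoxHom hbox P X P ≫ (boxHom hbox P).map ((box.map f).app P ≫ g) =
      ((homTensor k P).map f).app P ≫ homTensorToBoxHom hbox P X' P ≫ (boxHom hbox P).map g
    rw [Functor.map_comp, ← Category.assoc, homTensorToBoxHom_natural_left, Category.assoc]
  obtain ⟨a1, a2, a3⟩ := hbox.right X
  obtain ⟨b1, b2, b3⟩ := hM.right X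
  refine bijective_of_bijective_generator (box.obj X) ((homTensor k P).obj X)
    (fun Y => boxAdjoint hbox P X Y W) (fun {Y Y'} f g => ?_) hP (h₁ X) Y
  change homTensorToBoxHom hbox P X Y ≫ (boxHom hbox P).map ((box.obj X).map f ≫ g) =
    ((homTensor k P).obj X).map f ≫ homTensorToBoxHom hbox P X Y' ≫ (boxHom hbox P).map g
  rw [Functor.map_comp, ← Category.assoc, homTensorToBoxHom_natural_right, Category.assoc]

end Box

/-! ### `P ⊠ P` is a projective generator. -/

section DeligneGenerator

open TensorProduct

variable {k : Type w} [Field k] {C : Type u} [Category.{v} C] [Abelian C] [Linear k C]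
  {D : Type u'} [Category.{v} D] [Abelian D] [Linear k D] {box : C ⥤ C ⥤ D}

/-- The bifunctor `(X, Y) ↦ Hom(P, X) ⊗ Hom(P, Y)` with values in finitely generated modules. -/
noncomputable def homTensorFG (P : C) (hfin : ∀ X Y : C, FiniteDimensional k (X ⟶ Y)) :
    C ⥤ C ⥤ FGModuleCat.{v} (EndOpTensor k P) where
  obj X := ObjectProperty.lift _ ((homTensor k P).obj X) fun Y => finite_homTensor k P hfin X Y
  map f := { app := fun Y => ObjectProperty.homMk (((homTensor k P).map f).app Y)
             naturality := fun _ _ g =>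
              ObjectProperty.hom_ext _ (((homTensor k P).map f).naturality g) }
  map_id X := by
    ext1; ext1 Y
    exact ObjectProperty.hom_ext _ (congrArg (fun q => q.app Y) ((homTensor k P).map_id X))
  map_comp f g := by
    ext1; ext1 Y
    exact ObjectProperty.hom_ext _ (congrArg (fun q => q.app Y) ((homTensor k P).map_comp f g))

theorem isBilinearRightExact_homTensorFG (P : C) [Projective P]
    (hfin : ∀ X Y : C, FiniteDimensional k (X ⟶ Y)) [IsNoetherianRing (EndOpTensor k P)] :
    IsBilinearRightExact k (homTensorFG P hfin) where
  left Y := isLinearRightExact_of_comp_FGModuleCat_ι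
    ((isBilinearRightExact_homTensor k P).left Y)
  right X := isLinearRightExact_of_comp_FGModuleCat_ι
    ((isBilinearRightExact_homTensor k P).right X)

/-- If `P` is a projective generator of `C` then `P ⊠ P` is a projective generator of the Deligne
product of `C` with itself, and its Hom spaces are finite dimensional. -/
theorem IsDeligneSquare.isProjectiveGenerator
    (hbox : IsDeligneSquare.{w, v, u, u', max u u' (v + 1)} k box)
    (hfin : ∀ X Y : C, FiniteDimensional k (X ⟶ Y)) {P : C} (hP : IsProjectiveGenerator P) :
    IsProjectiveGenerator ((box.obj P).obj P) ∧
      ∀ Z : D, FiniteDimensional k ((box.obj P).obj P ⟶ Z) := by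
  have := hP.projective
  have := finite_endOpTensor k P hfin
  have := isNoetherianRing_endOpTensor k P hfin
  obtain ⟨G, hG, ⟨ε⟩⟩ := IsDeligneSquare.exists_extension.{w, v, u, u', max u u', v + 1} hbox
    (isBilinearRightExact_homTensorFG P hfin)
  let K := boxHom hbox.bilinear P
  let j := (ModuleCat.isFG.{v} (EndOpTensor k P)).ι
  have hK : K.Linear k := inferInstanceAs ((homFunctor _).Linear k)
  have hdef₀ : K.leftAdjointObjIsDefined (((homTensor k P).obj P).obj P) :=
    Functor.CorepresentableBy.isCorepresentable (X := (box.obj P).obj P)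
      { homEquiv := fun {W} => Equiv.ofBijective _ (bijective_boxAdjoint_self hbox.bilinear P W)
        homEquiv_comp := fun {W W'} g f => by
          change homTensorToBoxHom hbox.bilinear P P P ≫ K.map (f ≫ g) =
            (homTensorToBoxHom hbox.bilinear P P P ≫ K.map f) ≫ K.map g
          rw [K.map_comp, Category.assoc] }
  -- Finite generation matters here: `D` has only finite colimits to build the adjoint from, and
  -- every object of this category has a finite free presentation.
  have hdef (U : FGModuleCat.{v} (EndOpTensor k P)) : K.leftAdjointObjIsDefined (j.obj U) :=
    Functor.leftAdjointObjIsDefined_of_generator K j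
      (exists_epi_FGModuleCat (M := ((homTensorFG P hfin).obj P).obj P) (homTensorSelf k P)) hdef₀ U
  have hΓ (Z : D) : K.leftAdjointObjIsDefined ((G ⋙ j).obj Z) := hdef (G.obj Z)
  obtain ⟨a1, a2, a3⟩ := hG.comp (isLinearRightExact_FGModuleCat_ι k)
  let S := Functor.compPartialLeftAdjoint hΓ
  have hS : IsLinearRightExact k S := ⟨inferInstance,
    Functor.linear_compPartialLeftAdjoint hΓ k,
    Functor.preservesFiniteColimits_compPartialLeftAdjoint hΓ⟩
  let η {Z W : D} : (S.obj Z ⟶ W) ≃ ((G ⋙ j).obj Z ⟶ K.obj W) :=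
    Functor.compPartialLeftAdjointHomEquiv hΓ
  let ε' (X Y : C) : (G ⋙ j).obj ((box.obj X).obj Y) ≅ ((homTensor k P).obj X).obj Y :=
    j.mapIso ((ε.app X).app Y)
  let c (X Y : C) : S.obj ((box.obj X).obj Y) ⟶ (box.obj X).obj Y :=
    η.symm ((ε' X Y).hom ≫ homTensorToBoxHom hbox.bilinear P X Y)
  have hc (X Y : C) : η (c X Y) = (ε' X Y).hom ≫ homTensorToBoxHom hbox.bilinear P X Y :=
    η.apply_symm_apply _
  -- By Yoneda: under `η` and `ε'`, precomposition with `c X Y` becomes `boxAdjoint`.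
  have hc_iso (X Y : C) : IsIso (c X Y) := by
    rw [isIso_iff_coyoneda_map_bijective]
    intro W
    have h1 := bijective_boxAdjoint hbox.bilinear P hP.generates X Y W
    have h2 := (η.symm.bijective.comp
      ((ε' X Y).symm.homCongr (Iso.refl (K.obj W))).bijective).comp h1
    convert h2 using 1
    funext f
    refine η.injective ?_
    refine (Functor.compPartialLeftAdjointHomEquiv_comp hΓ _ _).trans ?_
    change η (c X Y) ≫ _ = η (η.symm _)
    rw [hc, Equiv.apply_symm_apply]
    simp [Iso.homCongr, boxAdjoint, K]
  have c_natural_right (X : C) {Y Y' : C} (g : Y ⟶ Y') :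
      S.map ((box.obj X).map g) ≫ c X Y' = c X Y ≫ (box.obj X).map g := by
    refine η.injective ?_
    refine (Functor.compPartialLeftAdjointHomEquiv_map_comp hΓ _ _).trans
      (Eq.trans ?_ (Functor.compPartialLeftAdjointHomEquiv_comp hΓ _ _).symm)
    change _ ≫ η (c X Y') = η (c X Y) ≫ _
    have hε : (G ⋙ j).map ((box.obj X).map g) ≫ (ε' X Y').hom =
        (ε' X Y).hom ≫ ((homTensor k P).obj X).map g :=
      congrArg (fun q => j.map q) ((ε.app X).hom.naturality g)
    rw [hc, hc, ← Category.assoc, hε, Category.assoc, Category.assoc,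
      homTensorToBoxHom_natural_right]
  have c_natural_left {X X' : C} (f : X ⟶ X') (Y : C) :
      S.map ((box.map f).app Y) ≫ c X' Y = c X Y ≫ (box.map f).app Y := by
    refine η.injective ?_
    refine (Functor.compPartialLeftAdjointHomEquiv_map_comp hΓ _ _).trans
      (Eq.trans ?_ (Functor.compPartialLeftAdjointHomEquiv_comp hΓ _ _).symm)
    change _ ≫ η (c X' Y) = η (c X Y) ≫ _
    have hε : (G ⋙ j).map ((box.map f).app Y) ≫ (ε' X' Y).hom =
        (ε' X Y).hom ≫ ((homTensor k P).map f).app Y :=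
      congrArg (fun q => j.map q) (NatTrans.congr_app (ε.hom.naturality f) Y)
    rw [hc, hc, ← Category.assoc, hε, Category.assoc, Category.assoc,
      homTensorToBoxHom_natural_left]
  let e : (Functor.postcompose₂.obj S).obj box ≅ (Functor.postcompose₂.obj (𝟭 D)).obj box :=
    NatIso.ofComponents (fun X => NatIso.ofComponents
      (fun Y => @asIso _ _ _ _ (c X Y) (hc_iso X Y)) fun g => c_natural_right X g)
      fun f => NatTrans.ext (funext fun Y => c_natural_left f Y)
  -- `S` and the identity agree on all `X ⊠ Y`, hence are isomorphic. Through `s`, the adjunction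
  -- for `S` becomes `Hom(Z, W) ≅ Hom(G Z, K W)`.
  obtain ⟨s⟩ := IsDeligneSquare.nonempty_iso.{w, v, u, u', max u (v + 1), u'} hbox hS
    ⟨inferInstance, ⟨fun _ _ => rfl⟩, inferInstance⟩ e
  have hθ (Z W : D) (h : Z ⟶ W) : η (s.hom.app Z) ≫ K.map h = η (s.hom.app Z ≫ h) :=
    (Functor.compPartialLeftAdjointHomEquiv_comp hΓ _ _).symm
  let θ : G ⋙ j ⟶ K :=
    { app := fun Z => η (s.hom.app Z)
      naturality := fun Z W h => by
        rw [hθ]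
        refine (Functor.compPartialLeftAdjointHomEquiv_map_comp hΓ h (s.hom.app W)).symm.trans ?_
        exact congrArg η (s.hom.naturality h) }
  refine isProjectiveGenerator_of_comparison hG θ (fun Z W => ?_)
    ((homTensorSelf k P).trans (ε' P P).symm.toLinearEquiv)
  have : (fun h : Z ⟶ W => θ.app Z ≫ K.map h) = η ∘ fun h => s.hom.app Z ≫ h :=
    funext fun h => hθ Z W h
  rw [this]
  exact η.bijective.comp ((isIso_iff_coyoneda_map_bijective _).1 inferInstance W)

end DeligneGenerator

/-! ### Universality of the pairing `β_U`. -/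

namespace Conjugates

variable {k : Type w} [Field k] {C : Type u} [Category.{v} C] [Abelian C]
  [Linear k C] [MonoidalCategory C] (c : Conjugates k C)

/-- Every morphism `U ⊗ V ⟶ 𝟙^*` is obtained from the pairing `β_U` by a morphism `V ⟶ U^*`. -/
theorem exists_whiskerLeft_comp_pairing (U V : C) (g : U ⊗ V ⟶ c.conj (𝟙_ C)) :
    ∃ b : V ⟶ c.conj U, (U ◁ b) ≫ c.pairing U = g := by
  let h : U ⟶ c.conj V := (c.π U V).symm g
  let b : V ⟶ c.conj U := c.δ.hom.app V ≫ c.star.map h.op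
  refine ⟨b, ?_⟩
  -- Here `b^* ∘ δ_U = (δ_V)^* ∘ h^{**} ∘ δ_U = (δ_V)^* ∘ δ_{V^*} ∘ h`, and `(δ_V)^*` is the inverse
  -- of `δ_{V^*}`.
  have hb : c.δ.hom.app U ≫ c.star.map b.op = h := by
    have nat : c.δ.hom.app U ≫ c.star.map (c.star.map h.op).op = h ≫ c.δ.hom.app (c.conj V) :=
      (c.δ.hom.naturality h).symm
    rw [op_comp, c.star.map_comp, reassoc_of% nat, c.star_δ]
    exact (congrArg (h ≫ ·) (c.δ.hom_inv_id_app (c.conj V))).trans (Category.comp_id h)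
  rw [pairing, ← c.π_natural_right, hb]
  exact (c.π U V).apply_symm_apply g

end Conjugates

/-! ### Representing `Hom(T -, W)` by a cokernel. -/

section Cokernel

variable {k : Type w} [Field k]
  {D : Type u'} [Category.{v} D] [Abelian D] [Linear k D]
  {C : Type u} [Category.{v} C] [Abelian C] [Linear k C]

/-- The natural transformation `Hom(-, R) → Hom(T -, W)` attached to `r : T R ⟶ W`. -/
def yonedaTransformation (T : D ⥤ C) [T.Additive] [T.Linear k] {R : D} {W : C}
    (r : T.obj R ⟶ W) :
    (linearYoneda k D).obj R ⟶ T.op ⋙ (linearYoneda k C).obj W where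
  app X := ModuleCat.ofHom ((Linear.rightComp k (T.obj X.unop) r).comp (T.mapLinearMap k))
  naturality X Y f := ModuleCat.hom_ext (LinearMap.ext fun (g : X.unop ⟶ R) => by
    change T.map (f.unop ≫ g) ≫ r = T.map f.unop ≫ T.map g ≫ r
    rw [T.map_comp, Category.assoc])

/-- `χ` is the inverse of `yonedaTransformation`, which sends `𝟙 R` to `r`. -/
theorem exists_iso_of_bijective (T : D ⥤ C) [T.Additive] [T.Linear k] {R : D} {W : C}
    (r : T.obj R ⟶ W) (h : ∀ X : D, Function.Bijective fun f : X ⟶ R => T.map f ≫ r) :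
    ∃ χ : T.op ⋙ (linearYoneda k C).obj W ≅ (linearYoneda k D).obj R,
      χ.hom.app (op R) r = 𝟙 R := by
  have (X : Dᵒᵖ) : IsIso ((yonedaTransformation (k := k) T r).app X) :=
    (ConcreteCategory.isIso_iff_bijective _).2 (h X.unop)
  have := NatIso.isIso_of_isIso_app (yonedaTransformation (k := k) T r)
  refine ⟨(asIso (yonedaTransformation (k := k) T r)).symm, (h R).1 ?_⟩
  have h' := congrArg (fun q => q.hom r)
    ((asIso (yonedaTransformation (k := k) T r)).inv_hom_id_app (op R))
  refine Eq.trans h' ?_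
  change r = T.map (𝟙 R) ≫ r
  rw [T.map_id, Category.id_comp]

/-- Let `q : Y ⟶ R` be the cokernel of a morphism `n : Z ⟶ Y` such that for a projective
generator `Q` of `D`, the morphisms `Q ⟶ Y` that factor through `n` are those which are killed by
`f ↦ T f ≫ β`.  If this map is surjective onto `Hom(T Q, W)`, then `R` represents
`Hom(T -, W)`. -/
theorem exists_representation_cokernel {T : D ⥤ C} (hT : IsLinearRightExact k T)
    {Q Y Z : D} (hQ : IsProjectiveGenerator Q) {W : C} (β : T.obj Y ⟶ W) (n : Z ⟶ Y)
    (hn : T.map n ≫ β = 0)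
    (hker : ∀ f : Q ⟶ Y, T.map f ≫ β = 0 → ∃ g : Q ⟶ Z, g ≫ n = f)
    (hsurj : ∀ g : T.obj Q ⟶ W, ∃ f : Q ⟶ Y, T.map f ≫ β = g) :
    ∃ r' : T.obj (cokernel n) ⟶ W,
      (∀ s : T.obj (cokernel n) ⟶ W, T.map (cokernel.π n) ≫ s = β ↔ s = r') ∧
      ∃ χ : T.op ⋙ (linearYoneda k C).obj W ≅ (linearYoneda k D).obj (cokernel n),
        χ.hom.app (op (cokernel n)) r' = 𝟙 (cokernel n) := by
  obtain ⟨h1, h2, h3⟩ := hT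
  have := hQ.projective
  have hc : IsColimit (CokernelCofork.ofπ (T.map (cokernel.π n)) (by
      rw [← T.map_comp, cokernel.condition, T.map_zero]) : CokernelCofork (T.map n)) :=
    isColimitCoforkMapOfIsColimit' T (cokernel.condition n) (cokernelIsCokernel n)
  obtain ⟨r', hr'⟩ : ∃ r' : T.obj (cokernel n) ⟶ W, T.map (cokernel.π n) ≫ r' = β :=
    ⟨hc.desc (CokernelCofork.ofπ β hn), hc.fac (CokernelCofork.ofπ β hn) .one⟩
  refine ⟨r', fun s => ⟨fun hs => ?_, fun hs => hs ▸ hr'⟩, exists_iso_of_bijective T r' ?_⟩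
  · rw [← cancel_epi (T.map (cokernel.π n)), hs, hr']
  -- It remains to check the object `Q`: `hker` gives injectivity, after lifting along the cokernel,
  -- and `hsurj` gives surjectivity.
  refine bijective_of_bijective_generator (𝟭 D) T
    (fun X => ((Linear.rightComp k (T.obj X) r').comp (T.mapLinearMap k)).toAddMonoidHom)
    (fun {X X'} f g => ?_) hQ.generates ⟨(injective_iff_map_eq_zero _).2 fun f hf => ?_, fun g => ?_⟩
  · change T.map (f ≫ g) ≫ r' = T.map f ≫ T.map g ≫ r'
    rw [T.map_comp, Category.assoc]
  · change Q ⟶ cokernel n at f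
    change T.map f ≫ r' = 0 at hf
    change f = 0
    have hp : Projective.factorThru f (cokernel.π n) ≫ cokernel.π n = f :=
      Projective.factorThru_comp _ _
    obtain ⟨g, hg⟩ := hker (Projective.factorThru f (cokernel.π n)) (by
      rw [← hr', ← Category.assoc, ← T.map_comp, hp, hf])
    rw [← hp, ← hg, Category.assoc, cokernel.condition, comp_zero]
  · obtain ⟨f, hf⟩ := hsurj g
    refine ⟨f ≫ cokernel.π n, ?_⟩
    change T.map (f ≫ cokernel.π n) ≫ r' = g
    rw [T.map_comp, Category.assoc, hr', hf]

end Cokernel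

/-! ### The representing object. -/

theorem mainTheorem4
    {k : Type w} [Field k] [CharZero k]
    {C : Type u} [Category.{v} C] [Abelian C] [Linear k C]
    [MonoidalCategory C] [BraidedCategory C]
    (hTensor : IsBilinearRightExact k (curriedTensor C))
    (hPF : SatisfiesPF k C)
    (c : Conjugates k C)
    {D : Type u'} [Category.{v} D] [Abelian D] [Linear k D]
    (box : C ⥤ C ⥤ D)
    (hbox : IsDeligneSquare.{w, v, u, u', max u u' (v + 1)} k box)
    (T : D ⥤ C) (hT : IsLinearRightExact k T)
    (τ : (Functor.postcompose₂.obj T).obj box ≅ curriedTensor C)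
    (P : C) (hP : IsProjectiveGenerator P) :
    FiniteDimensional k (relationSpace c hT τ P) ∧
    (∀ {r : ℕ} (b : Module.Basis (Fin r) k (relationSpace c hT τ P)),
      ∃ r' : T.obj (cokernel (relationMap c hT τ P b)) ⟶ c.conj (𝟙_ C),
        (∀ s : T.obj (cokernel (relationMap c hT τ P b)) ⟶ c.conj (𝟙_ C),
          T.map (cokernel.π (relationMap c hT τ P b)) ≫ s =
              (boxTensorIso τ P (c.conj P)).hom ≫ c.pairing P ↔ s = r') ∧
        ∃ χ : T.op ⋙ (linearYoneda k C).obj (c.conj (𝟙_ C)) ≅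
            (linearYoneda k D).obj (cokernel (relationMap c hT τ P b)),
          χ.hom.app (op (cokernel (relationMap c hT τ P b))) r' =
            𝟙 (cokernel (relationMap c hT τ P b))) ∧
    ∃ R : D, Nonempty (T.op ⋙ (linearYoneda k C).obj (c.conj (𝟙_ C)) ≅
      (linearYoneda k D).obj R) := by
  obtain ⟨hQ, hQfin⟩ := hbox.isProjectiveGenerator hPF.finiteDimensional_hom hP
  have := hQfin ((box.obj P).obj (c.conj P))
  have := hT.additive
  have hfin : FiniteDimensional k (relationSpace c hT τ P) := inferInstance
  have mem_iff (f : (box.obj P).obj P ⟶ (box.obj P).obj (c.conj P)) :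
      f ∈ relationSpace c hT τ P ↔
        T.map f ≫ (boxTensorIso τ P (c.conj P)).hom ≫ c.pairing P = 0 := by
    change (boxTensorIso τ P P).inv ≫ T.map f ≫ _ ≫ _ = 0 ↔ _
    rw [← cancel_epi (boxTensorIso τ P P).inv, comp_zero]
  have rep {r : ℕ} (b : Module.Basis (Fin r) k (relationSpace c hT τ P)) :=
    exists_representation_cokernel hT hQ
      ((boxTensorIso τ P (c.conj P)).hom ≫ c.pairing P) (relationMap c hT τ P b)
      (by
        rw [relationMap, T.map_sum, Preadditive.sum_comp]
        refine Finset.sum_eq_zero fun i _ => ?_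
        rw [T.map_comp, Category.assoc, (mem_iff _).1 (b i).2, comp_zero])
      (fun f hf => by
        -- The coordinates of `f` in the basis of `N` are the components of its factorization
        -- through `n`.
        let a := b.repr ⟨f, (mem_iff f).2 hf⟩
        refine ⟨∑ i, a i • biproduct.ι (fun _ : Fin r => (box.obj P).obj P) i, ?_⟩
        have h : (∑ i, a i • b i : relationSpace c hT τ P) = ⟨f, (mem_iff f).2 hf⟩ := b.sum_repr _
        have h' : ∑ i, a i • (b i).1 = f := by simpa using congrArg Subtype.val h
        rw [Preadditive.sum_comp]
        refine Eq.trans (Finset.sum_congr rfl fun i _ => ?_) h'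
        rw [Linear.smul_comp]
        congr 1
        rw [relationMap, Preadditive.comp_sum, Finset.sum_eq_single i]
        · simp
        · intro j _ hj
          rw [biproduct.ι_π_ne_assoc _ hj.symm, zero_comp]
        · simp)
      (fun g => by
        -- The preimage is `P ⊠ b`, which `T` turns into `P ⊗ b`.
        obtain ⟨b, hb⟩ := c.exists_whiskerLeft_comp_pairing P P ((boxTensorIso τ P P).inv ≫ g)
        refine ⟨(box.obj P).map b, ?_⟩
        have nat : T.map ((box.obj P).map b) ≫ (boxTensorIso τ P (c.conj P)).hom =
            (boxTensorIso τ P P).hom ≫ P ◁ b := (τ.app P).hom.naturality b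
        rw [reassoc_of% nat, hb, Iso.hom_inv_id_assoc])
  refine ⟨hfin, fun b => rep b, ?_⟩
  obtain ⟨_, _, χ, _⟩ := rep (Module.finBasis k (relationSpace c hT τ P))
  exact ⟨_, ⟨χ⟩⟩
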